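/- **Coarse upper bound for the ICL risk.** Let $d,M\ge 1$. *Pretraining model:* a task $(\mu,w)\in\mathbb R^d\times\mathbb R^d$ is drawn from the prior $\sum_{m=1}^M\pi_m\,\mathcal N(\mu_m,\sigma_\mu^2 I)\otimes\mathcal N(w_m,\sigma_w^2 I)$, where $\pi_m>0$, $\sum_m\pi_m=1$, $\|\mu_m\|=\|w_m\|=1$ and $\sigma_\mu,\sigma_w>0$. Given the task, the samples $(x_i,y_i)$, $i=1,\dots,K$, are i.i.d. with $x_i\sim\mathcal N(\mu,\sigma_x^2I)$ and $y_i\mid x_i\sim\mathcal N(\langle w,x_i\rangle,\sigma_y^2)$, where $\sigma_x,\sigma_y>0$. Put $\mathcal S_k\oplus x_{k+1}=(x_1,y_1,\dots,x_k,y_k,x_{k+1})$ and $\delta_w=\sigma_w^2/\sigma_y^2$. A predictor $\mathcal F=(\mathcal F_0,\dots,\mathcal F_{K-1})$, with $\mathcal F_k$ a real function of $\mathcal S_k\oplus x_{k+1}$, has *optimal pretraining risk* if it is measurable and minimizes $\mathbb E\big[\frac1K\sum_{k=0}^{K-1}(\mathcal F_k(\mathcal S_k\oplus x_{k+1})-y_{k+1})^2\big]$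 among all measurable predictors. The *Bayes predictor* maps each $\mathcal S_k\oplus x_{k+1}$ to the mean of $\langle w,x_{k+1}\rangle$ under the posterior of $(\mu,w)$ given by Bayes' formula, i.e. the prior reweighted by the Gaussian likelihood of $\mathcal S_k\oplus x_{k+1}$ and normalized. *In-context examples:* let $\|\mu^*\|=\|w^*\|=1$ and $\tau_x>0$, let $x_1,\dots,x_{k+1}$ be i.i.d. $\mathcal N(\mu^*,\tau_x^2I)$ and $y_i=\langle x_i,w^*\rangle$ (no label noise), and let $\mathcal L_k^*=(\mathcal F_k(\mathcal S_k\oplus x_{k+1})-\langle x_{k+1},w^*\rangle)^2$. Then the Bayes predictor is continuous and has optimal pretraining risk for every $K$. Moreover, for every $\delta>0$ there are $C$ and $k_0$ (depending on the pretraining model, $\mu^*,w^*,\tau_x,\delta$, but not on $K$ or $\mathcal F$) such that for all $K>k\ge k_0$ and every continuous predictor $\mathcal F$ with optimal pretraining risk (in particular for the Bayes predictor), $$\mathbb E_{\mathcal S_k\oplus x_{k+1}}[\mathcal L_k^*]<\frac{4(1+d\tau_x^2)}{\tau_x^4\,\delta_w^2\,k^2}+C\,k^{\delta-5/2}.$$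 Thus the ICL risk decays at the rate $1/k^2$ as $k\to\infty$. -/

import Mathlib

open MeasureTheory ProbabilityTheory
open scoped ENNReal NNReal

noncomputable section

/-- Tokens `x` and task parameters `μ`, `w` live in Euclidean `d`-space. -/
abbrev Vec (d : ℕ) : Type := EuclideanSpace ℝ (Fin d)

/-- A sequence `x₁, y₁, …, x_k, y_k, x_{k+1}`: `k` labeled samples and one unlabeled input. -/
abbrev Prompt (d k : ℕ) : Type := (Fin k → Vec d × ℝ) × Vec d

/-- A next-token predictor for sequences of `K` labeled samples: one predictor for each
number `k < K` of preceding labeled samples. -/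
abbrev Predictor (d K : ℕ) : Type := (k : Fin K) → Prompt d k → ℝ

/-- The isotropic Gaussian law `N(c, s² I)`. -/
def isoGaussian {d : ℕ} (c : Vec d) (s : ℝ) : Measure (Vec d) :=
  multivariateGaussian c (s ^ 2 • (1 : Matrix (Fin d) (Fin d) ℝ))

/-- The density of `N(c, s² I)` at `x`. -/
def isoGaussianDensity {d : ℕ} (c : Vec d) (s : ℝ) (x : Vec d) : ℝ :=
  (Real.sqrt (2 * Real.pi * s ^ 2))⁻¹ ^ d * Real.exp (-‖x - c‖ ^ 2 / (2 * s ^ 2))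

/-- Parameters of the pretraining data model: a Gaussian mixture prior with `M` components over
tasks `(μ, w)`, Gaussian inputs and noisy linear labels. -/
structure PretrainModel (d M : ℕ) where
  /-- mixture weights -/
  weight : Fin M → ℝ
  /-- centers `μ_m` -/
  muCenter : Fin M → Vec d
  /-- centers `w_m` -/
  wCenter : Fin M → Vec d
  sigmaMu : ℝ
  sigmaW : ℝ
  sigmaX : ℝ
  sigmaY : ℝ
  weight_pos : ∀ m, 0 < weight m
  weight_sum : ∑ m, weight m = 1
  norm_muCenter : ∀ m, ‖muCenter m‖ = 1
  norm_wCenter : ∀ m, ‖wCenter m‖ = 1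
  sigmaMu_pos : 0 < sigmaMu
  sigmaW_pos : 0 < sigmaW
  sigmaX_pos : 0 < sigmaX
  sigmaY_pos : 0 < sigmaY

namespace PretrainModel

variable {d M : ℕ} (P : PretrainModel d M)

/-- `δ_w = σ_w² / σ_y²`. -/
def deltaW : ℝ := P.sigmaW ^ 2 / P.sigmaY ^ 2

/-- The task prior: the law of `(μ, w)`. -/
def prior : Measure (Vec d × Vec d) :=
  ∑ m, ENNReal.ofReal (P.weight m) •
    (isoGaussian (P.muCenter m) P.sigmaMu).prod (isoGaussian (P.wCenter m) P.sigmaW)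

/-- The law of one labeled sample `(x, y)` of the task `t = (μ, w)`: `x ∼ N(μ, σ_x² I)` and
`y = ⟨w, x⟩ + e` with `e ∼ N(0, σ_y²)` independent of `x`, so `y | x ∼ N(⟨w, x⟩, σ_y²)`. -/
def sampleLaw (t : Vec d × Vec d) : Measure (Vec d × ℝ) :=
  ((isoGaussian t.1 P.sigmaX).prod (gaussianReal 0 ⟨P.sigmaY ^ 2, sq_nonneg _⟩)).map
    (fun p => (p.1, inner ℝ t.2 p.1 + p.2))

/-- The pretraining risk `E[(1/K) ∑_{k<K} (F_k(S_k ⊕ x_{k+1}) - y_{k+1})²]`, where a task is drawn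
from the prior and then `K` i.i.d. samples are drawn from the task. -/
def pretrainRisk (K : ℕ) (F : Predictor d K) : ℝ≥0∞ :=
  ∫⁻ t, ∫⁻ S : Fin K → Vec d × ℝ,
    ENNReal.ofReal ((1 / (K : ℝ)) *
      ∑ k : Fin K, (F k (fun i => S (Fin.castLE k.isLt.le i), (S k).1) - (S k).2) ^ 2)
    ∂(Measure.pi fun _ => P.sampleLaw t) ∂P.prior

/-- `F` attains the optimal pretraining risk among all measurable predictors. -/
def IsOptimal (K : ℕ) (F : Predictor d K) : Prop :=
  (∀ k, Measurable (F k)) ∧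
    ∀ G : Predictor d K, (∀ k, Measurable (G k)) → P.pretrainRisk K F ≤ P.pretrainRisk K G

/-- The likelihood of the observation `S_k ⊕ x_{k+1}` under the task `t = (μ, w)`. -/
def likelihood {k : ℕ} (q : Prompt d k) (t : Vec d × Vec d) : ℝ :=
  (∏ i, isoGaussianDensity t.1 P.sigmaX (q.1 i).1 *
      gaussianPDFReal (inner ℝ t.2 (q.1 i).1) ⟨P.sigmaY ^ 2, sq_nonneg _⟩ (q.1 i).2) *
    isoGaussianDensity t.1 P.sigmaX q.2

/-- The Bayes predictor: the mean of `E[y_{k+1} | (μ, w), x_{k+1}] = ⟨w, x_{k+1}⟩` under the task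
posterior, whose density with respect to the prior is proportional to the likelihood. -/
def bayesPredictor (k : ℕ) (q : Prompt d k) : ℝ :=
  (∫ t, P.likelihood q t * inner ℝ t.2 q.2 ∂P.prior) / ∫ t, P.likelihood q t ∂P.prior

end PretrainModel

/-- The in-context-learning risk `E[(f(S_k ⊕ x_{k+1}) - ⟨x_{k+1}, w*⟩)²]` of `f` on `k` in-context
examples, where `x₁, …, x_{k+1}` are i.i.d. `N(μ*, τ² I)` and `y_i = ⟨x_i, w*⟩` without noise. -/
def iclRisk {d : ℕ} (muStar wStar : Vec d) (tau : ℝ) (k : ℕ) (f : Prompt d k → ℝ) : ℝ≥0∞ :=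
  ∫⁻ x : Fin (k + 1) → Vec d,
    ENNReal.ofReal
      ((f (fun i => (x i.castSucc, inner ℝ (x i.castSucc) wStar), x (Fin.last k))
        - inner ℝ (x (Fin.last k)) wStar) ^ 2)
    ∂(Measure.pi fun _ => isoGaussian muStar tau)

end

/-!
Bias-variance over the posterior shows that the pretraining risk of a predictor is that of the
Bayes predictor plus a nonnegative excess, the squared distance to the Bayes predictor weighted by
the marginal density of the prompt. This density is everywhere positive, so a continuous optimal
predictor is the Bayes predictor.

Given a prompt, the posterior of `w` is a mixture of Gaussians centered at the ridge estimates `u_m`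
with prior centers `w_m`: the component density is symmetric about `u_m`. On noiseless labels
`y_i = ⟨x_i, w*⟩` the normal equations read `(I + δ_w ∑ x_i x_iᵀ) (u_m - w*) = w_m - w*`, so the
prediction error is at most `(1 + ‖w*‖) ‖x_{k+1}‖ / (1 + δ_w λ)` for every lower bound `λ` of the
Gram form. One may take `λ = k τ² - R`, where the deviation `R` of the empirical second moments has
mean `O(√k)` and, by Cramér's bound, exceeds `k τ² / 2` with exponentially small probability.
-/

noncomputable section

section ProductMeasure

theorem lintegral_pi_prod {n : ℕ} {E : Fin n → Type*} [∀ i, MeasurableSpace (E i)]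
    (μ : ∀ i, Measure (E i)) [∀ i, SigmaFinite (μ i)] {f : ∀ i, E i → ℝ≥0∞}
    (hf : ∀ i, Measurable (f i)) :
    ∫⁻ x, ∏ i, f i (x i) ∂(Measure.pi μ) = ∏ i, ∫⁻ x, f i x ∂(μ i) := by
  induction n with
  | zero => simp
  | succ n ih =>
    have hg : Measurable fun y : ∀ i : Fin n, E i.succ => ∏ i, f i.succ (y i) :=
      Finset.measurable_fun_prod _ fun i _ => (hf i.succ).comp (measurable_pi_apply i)
    calc ∫⁻ x, ∏ i, f i (x i) ∂(Measure.pi μ)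
        = ∫⁻ z : E 0 × (∀ i : Fin n, E i.succ), f 0 z.1 * ∏ i, f i.succ (z.2 i)
            ∂((μ 0).prod (Measure.pi fun i : Fin n => μ i.succ)) := by
          simp only [Fin.prod_univ_succ]
          exact (measurePreserving_piFinSuccAbove μ 0).lintegral_comp
            (((hf 0).comp measurable_fst).mul (hg.comp measurable_snd))
      _ = ∏ i, ∫⁻ x, f i x ∂(μ i) := by
          rw [lintegral_prod_mul (hf 0).aemeasurable hg.aemeasurable,
            ih _ fun i => hf i.succ, Fin.prod_univ_succ]

theorem pi_withDensity {n : ℕ} {E : Fin n → Type*} [∀ i, MeasurableSpace (E i)]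
    (μ : ∀ i, Measure (E i)) [∀ i, SigmaFinite (μ i)] {f : ∀ i, E i → ℝ≥0∞}
    (hf : ∀ i, Measurable (f i)) [∀ i, SigmaFinite ((μ i).withDensity (f i))] :
    Measure.pi (fun i => (μ i).withDensity (f i))
      = (Measure.pi μ).withDensity fun x => ∏ i, f i (x i) := by
  refine Measure.pi_eq fun s hs => ?_
  rw [withDensity_apply _ (MeasurableSet.univ_pi hs), Measure.restrict_pi_pi,
    lintegral_pi_prod _ hf]
  exact Finset.prod_congr rfl fun i _ => (withDensity_apply _ (hs i)).symm

theorem map_withDensity_comp {α β : Type*} [MeasurableSpace α] [MeasurableSpace β]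
    {μ : Measure α} {ν : Measure β} {e : α → β} (he : MeasurePreserving e μ ν)
    {g : β → ℝ≥0∞} (hg : Measurable g) :
    (μ.withDensity (g ∘ e)).map e = ν.withDensity g := by
  ext s hs
  rw [Measure.map_apply he.measurable hs, withDensity_apply _ (he.measurable hs),
    withDensity_apply _ hs, ← he.setLIntegral_comp_preimage hs hg]
  rfl

theorem measurePreserving_comp_injective_prodMk_eval {ι κ E : Type*} [Fintype ι] [Fintype κ]
    [MeasurableSpace E] (μ : κ → Measure E) [∀ j, IsProbabilityMeasure (μ j)] {e : ι → κ}
    (he : Function.Injective e) {j : κ} (hj : ∀ i, e i ≠ j) :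
    MeasurePreserving (fun S : κ → E => (fun i => S (e i), S j)) (Measure.pi μ)
      ((Measure.pi fun i => μ (e i)).prod (μ j)) := by
  classical
  have hcoord : iIndepFun (fun (j : κ) (S : κ → E) => S j) (Measure.pi μ) :=
    iIndepFun_pi (X := fun _ => id) fun _ => aemeasurable_id
  have hindep : IndepFun (fun (S : κ → E) i => S (e i)) (fun S => S j) (Measure.pi μ) :=
    (hcoord.indepFun_finset (Finset.univ.image e) {j} (by simpa using fun i => hj i)
      measurable_pi_apply).comp
      (φ := fun (S : Finset.univ.image e → E) i => S ⟨e i, by simp⟩)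
      (ψ := fun (S : ({j} : Finset κ) → E) => S ⟨j, by simp⟩) (by fun_prop) (by fun_prop)
  have hfst : (Measure.pi μ).map (fun S i => S (e i)) = Measure.pi fun i => μ (e i) := by
    rw [(iIndepFun_iff_map_fun_eq_pi_map fun i => (measurable_pi_apply _).aemeasurable).1
      (hcoord.precomp he)]
    exact congrArg _ (funext fun i => (measurePreserving_eval μ (e i)).map_eq)
  refine ⟨by fun_prop, ?_⟩
  have hmap := (indepFun_iff_map_prod_eq_prod_map_map
    (measurable_pi_lambda _ fun i => measurable_pi_apply (e i)).aemeasurable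
    (measurable_pi_apply j).aemeasurable).1 hindep
  rwa [hfst, show (Measure.pi μ).map (fun S => S j) = μ j from
    (measurePreserving_eval μ j).map_eq] at hmap

end ProductMeasure

section IsoGaussian

variable {d : ℕ}

instance isGaussian_isoGaussian (c : Vec d) (s : ℝ) : IsGaussian (isoGaussian c s) :=
  isGaussian_multivariateGaussian

theorem posSemidef_sq_smul_one (s : ℝ) :
    (s ^ 2 • (1 : Matrix (Fin d) (Fin d) ℝ)).PosSemidef :=
  Matrix.PosSemidef.one.smul (sq_nonneg s)

theorem isoGaussian_eq_map_pi (c : Vec d) (s : ℝ) :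
    isoGaussian c s
      = (Measure.pi fun i => gaussianReal (c i) (s ^ 2).toNNReal).map (WithLp.toLp 2) := by
  apply Measure.ext_of_charFun (E := Vec d)
  ext t
  rw [isoGaussian, charFun_multivariateGaussian (posSemidef_sq_smul_one s), charFun_pi]
  simp_rw [charFun_gaussianReal, ← Complex.exp_sum, Finset.sum_sub_distrib]
  congr 2
  · simp [PiLp.inner_apply, Finset.sum_mul, mul_assoc, mul_left_comm]
  · simp [Matrix.smul_mulVec, dotProduct, Finset.sum_div, pow_two, mul_left_comm, mul_self_nonneg]

theorem isoGaussianDensity_pos (c : Vec d) {s : ℝ} (hs : 0 < s) (x : Vec d) :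
    0 < isoGaussianDensity c s x := by
  have := Real.pi_pos
  unfold isoGaussianDensity
  positivity

theorem continuous_isoGaussianDensity (c : Vec d) (s : ℝ) :
    Continuous (isoGaussianDensity c s) := by
  unfold isoGaussianDensity
  fun_prop

theorem isoGaussianDensity_le (c : Vec d) (s : ℝ) (x : Vec d) :
    isoGaussianDensity c s x ≤ (Real.sqrt (2 * Real.pi * s ^ 2))⁻¹ ^ d := by
  refine mul_le_of_le_one_right (by positivity) (Real.exp_le_one_iff.2 ?_)
  exact div_nonpos_of_nonpos_of_nonneg (neg_nonpos.2 (by positivity)) (by positivity)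

theorem gaussianPDFReal_le (c : ℝ) (v : ℝ≥0) (x : ℝ) :
    gaussianPDFReal c v x ≤ (Real.sqrt (2 * Real.pi * v))⁻¹ := by
  refine mul_le_of_le_one_right (by positivity) (Real.exp_le_one_iff.2 ?_)
  exact div_nonpos_of_nonpos_of_nonneg (neg_nonpos.2 (by positivity)) (by positivity)

theorem isoGaussianDensity_eq_prod (c : Vec d) (s : ℝ) (x : Vec d) :
    isoGaussianDensity c s x = ∏ i, gaussianPDFReal (c i) (s ^ 2).toNNReal (x i) := by
  simp [gaussianPDFReal, isoGaussianDensity, Finset.prod_mul_distrib, ← Real.exp_sum,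
    EuclideanSpace.real_norm_sq_eq, Finset.sum_div, neg_div, Real.coe_toNNReal _ (sq_nonneg s)]

theorem isoGaussian_eq_withDensity (c : Vec d) {s : ℝ} (hs : 0 < s) :
    isoGaussian c s
      = volume.withDensity fun x => ENNReal.ofReal (isoGaussianDensity c s x) := by
  set v : ℝ≥0 := (s ^ 2).toNNReal with hv_def
  have hv : v ≠ 0 := (Real.toNNReal_pos.2 (pow_pos hs 2)).ne'
  have (i : Fin d) : SigmaFinite (volume.withDensity (gaussianPDF (c i) v)) := by
    rw [← gaussianReal_of_var_ne_zero _ hv]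
    infer_instance
  have hpi : (Measure.pi fun i => gaussianReal (c i) v)
      = (volume : Measure (Fin d → ℝ)).withDensity
        ((fun x : Vec d => ENNReal.ofReal (isoGaussianDensity c s x)) ∘ WithLp.toLp 2) := by
    simp_rw [gaussianReal_of_var_ne_zero _ hv]
    rw [pi_withDensity _ fun i => measurable_gaussianPDF _ _]
    refine congrArg _ (funext fun x => ?_)
    simp only [Function.comp, isoGaussianDensity_eq_prod, ← hv_def]
    exact (ENNReal.ofReal_prod_of_nonneg fun i _ => gaussianPDFReal_nonneg _ _ _).symm
  rw [isoGaussian_eq_map_pi, hpi, map_withDensity_comp (PiLp.volume_preserving_toLp (Fin d))]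
  exact (continuous_isoGaussianDensity c s).measurable.ennreal_ofReal

theorem integrable_norm_sq_isoGaussian (c : Vec d) (s : ℝ) :
    Integrable (fun x : Vec d => ‖x‖ ^ 2) (isoGaussian c s) :=
  IsGaussian.memLp_two_id.integrable_norm_pow (by norm_num)

theorem integral_inner_sq_isoGaussian (c v : Vec d) (s : ℝ) :
    ∫ x, (inner ℝ v x : ℝ) ^ 2 ∂(isoGaussian c s) = (inner ℝ v c : ℝ) ^ 2 + s ^ 2 * ‖v‖ ^ 2 := by
  have hL : MemLp (fun x : Vec d => (inner ℝ v x : ℝ)) 2 (isoGaussian c s) :=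
    IsGaussian.memLp_two_id.const_inner v
  have hmean : ∫ x, (inner ℝ v x : ℝ) ∂(isoGaussian c s) = inner ℝ v c := by
    rw [integral_inner IsGaussian.integrable_fun_id, isoGaussian, integral_id_multivariateGaussian]
  have hvar : Var[fun x => inner ℝ v x; isoGaussian c s] = s ^ 2 * ‖v‖ ^ 2 := by
    rw [← covarianceBilin_self IsGaussian.memLp_two_id, isoGaussian,
      covarianceBilin_multivariateGaussian (posSemidef_sq_smul_one s),
      EuclideanSpace.real_norm_sq_eq]
    simp [Matrix.smul_mulVec, dotProduct, pow_two, Finset.mul_sum, mul_left_comm]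
  rw [variance_eq_sub hL, hmean] at hvar
  exact sub_eq_iff_eq_add'.1 hvar

theorem integral_norm_sq_isoGaussian (c : Vec d) (s : ℝ) :
    ∫ x, ‖x‖ ^ 2 ∂(isoGaussian c s) = ‖c‖ ^ 2 + d * s ^ 2 := by
  have hsq (y : Vec d) : ‖y‖ ^ 2 = ∑ i, (inner ℝ (EuclideanSpace.single i (1 : ℝ)) y : ℝ) ^ 2 := by
    simp [EuclideanSpace.real_norm_sq_eq, EuclideanSpace.inner_single_left]
  have hi (i : Fin d) : Integrable
      (fun x : Vec d => (inner ℝ (EuclideanSpace.single i (1 : ℝ)) x : ℝ) ^ 2) (isoGaussian c s) :=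
    (IsGaussian.memLp_two_id.const_inner _).integrable_sq
  simp_rw [hsq]
  rw [integral_finsetSum _ fun i _ => hi i]
  simp_rw [integral_inner_sq_isoGaussian, Finset.sum_add_distrib]
  simp

theorem lintegral_norm_sq_isoGaussian (c : Vec d) (s : ℝ) :
    ∫⁻ x, ENNReal.ofReal (‖x‖ ^ 2) ∂(isoGaussian c s)
      = ENNReal.ofReal (‖c‖ ^ 2 + d * s ^ 2) := by
  rw [← ofReal_integral_eq_lintegral_ofReal (integrable_norm_sq_isoGaussian c s)
    (.of_forall fun x => sq_nonneg _), integral_norm_sq_isoGaussian]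

end IsoGaussian

theorem lintegral_const_add_gaussianReal (a : ℝ) {v : ℝ≥0} (hv : v ≠ 0) {g : ℝ → ℝ≥0∞}
    (hg : Measurable g) :
    ∫⁻ e, g (a + e) ∂(gaussianReal 0 v) = ∫⁻ y, gaussianPDF a v y * g y := by
  have hshift := gaussianReal_map_const_add (μ := 0) (v := v) a
  rw [zero_add] at hshift
  rw [← lintegral_map hg (by fun_prop), hshift, gaussianReal_of_var_ne_zero _ hv,
    lintegral_withDensity_eq_lintegral_mul _ (measurable_gaussianPDF _ _) hg]
  rfl

theorem lintegral_sub_sq_gaussianReal (a : ℝ) (v : ℝ≥0) :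
    ∫⁻ e, ENNReal.ofReal ((a - e) ^ 2) ∂(gaussianReal 0 v)
      = ENNReal.ofReal (a ^ 2) + ENNReal.ofReal v := by
  have hL : MemLp (fun e : ℝ => a - e) 2 (gaussianReal 0 v) :=
    (memLp_const a).sub IsGaussian.memLp_two_id
  have hmean : ∫ e, (a - e) ∂(gaussianReal 0 v) = a := by
    rw [integral_sub (integrable_const a) IsGaussian.integrable_fun_id]
    simp
  have hvar : Var[fun e => a - e; gaussianReal 0 v] = v := by
    rw [variance_const_sub (by fun_prop), variance_fun_id_gaussianReal]
  rw [variance_eq_sub hL, hmean] at hvar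
  rw [← ofReal_integral_eq_lintegral_ofReal hL.integrable_sq (.of_forall fun e => sq_nonneg _),
    ← ENNReal.ofReal_add (sq_nonneg a) v.coe_nonneg]
  exact congrArg _ (sub_eq_iff_eq_add'.1 hvar)

theorem integral_mul_sub_sq {α : Type*} [MeasurableSpace α] {ν : Measure α} {L g : α → ℝ}
    (hL : Integrable L ν) (hg : Integrable (fun t => L t * g t) ν)
    (hg2 : Integrable (fun t => L t * g t ^ 2) ν) (hZ : ∫ t, L t ∂ν ≠ 0) (a : ℝ) :
    ∫ t, L t * (a - g t) ^ 2 ∂ν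
      = (∫ t, L t ∂ν) * (a - (∫ t, L t * g t ∂ν) / ∫ t, L t ∂ν) ^ 2
        + ∫ t, L t * ((∫ t, L t * g t ∂ν) / (∫ t, L t ∂ν) - g t) ^ 2 ∂ν := by
  have hexpand (a : ℝ) : ∫ t, L t * (a - g t) ^ 2 ∂ν
      = a ^ 2 * (∫ t, L t ∂ν) - 2 * a * (∫ t, L t * g t ∂ν) + ∫ t, L t * g t ^ 2 ∂ν := by
    have hsub : Integrable (fun t => a ^ 2 * L t - 2 * a * (L t * g t)) ν :=
      (hL.const_mul _).sub (hg.const_mul _)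
    rw [← integral_const_mul, ← integral_const_mul,
      ← integral_sub (hL.const_mul _) (hg.const_mul _), ← integral_add hsub hg2]
    congr 1
    ext t
    ring
  rw [hexpand, hexpand]
  field_simp
  ring

instance sigmaFinite_volume_prompt (d k : ℕ) : SigmaFinite (volume : Measure (Prompt d k)) :=
  Measure.prod.instSigmaFinite

instance isOpenPosMeasure_volume_sample (d : ℕ) :
    (volume : Measure (Vec d × ℝ)).IsOpenPosMeasure :=
  Measure.prod.instIsOpenPosMeasure

instance isOpenPosMeasure_volume_prompt (d k : ℕ) :
    (volume : Measure (Prompt d k)).IsOpenPosMeasure :=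
  Measure.prod.instIsOpenPosMeasure

namespace PretrainModel

variable {d M : ℕ} (P : PretrainModel d M)

/-- The label noise variance `σ_y²` as a nonnegative real, the form in which
`ProbabilityTheory.gaussianReal` takes its variance. -/
def noiseVar : ℝ≥0 := ⟨P.sigmaY ^ 2, sq_nonneg _⟩

theorem coe_noiseVar : (P.noiseVar : ℝ) = P.sigmaY ^ 2 := rfl

theorem noiseVar_ne_zero : P.noiseVar ≠ 0 :=
  (show 0 < P.noiseVar from pow_pos P.sigmaY_pos 2).ne'

/-- The density of one labeled sample given the task `t = (μ, w)`. -/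
def sampleDensity (t : Vec d × Vec d) (p : Vec d × ℝ) : ℝ :=
  isoGaussianDensity t.1 P.sigmaX p.1 * gaussianPDFReal (inner ℝ t.2 p.1) P.noiseVar p.2

/-- The law of the observation `S_k ⊕ x_{k+1}` given the task. -/
def promptLaw (k : ℕ) (t : Vec d × Vec d) : Measure (Prompt d k) :=
  (Measure.pi fun _ => P.sampleLaw t).prod (isoGaussian t.1 P.sigmaX)

/-- The marginal likelihood of the observation `q`, the normalizing constant of the posterior. -/
def evidence {k : ℕ} (q : Prompt d k) : ℝ := ∫ t, P.likelihood q t ∂P.prior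

/-- The mean squared error of `f` as an estimate of `⟨w, x_{k+1}⟩`. -/
def estimationRisk (k : ℕ) (f : Prompt d k → ℝ) : ℝ≥0∞ :=
  ∫⁻ t, ∫⁻ q, ENNReal.ofReal ((f q - inner ℝ t.2 q.2) ^ 2) ∂(P.promptLaw k t) ∂P.prior

/-- The squared distance from `f` to the Bayes predictor under the marginal law of the observation.
It measures how far `f` is from optimal. -/
def excessRisk (k : ℕ) (f : Prompt d k → ℝ) : ℝ≥0∞ :=
  ∫⁻ q, ENNReal.ofReal (P.evidence q * (f q - P.bayesPredictor k q) ^ 2)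

section Densities

theorem sampleLaw_eq_map (t : Vec d × Vec d) : P.sampleLaw t =
    ((isoGaussian t.1 P.sigmaX).prod (gaussianReal 0 P.noiseVar)).map
      (fun p => (p.1, inner ℝ t.2 p.1 + p.2)) := rfl

instance isProbabilityMeasure_sampleLaw (t : Vec d × Vec d) :
    IsProbabilityMeasure (P.sampleLaw t) := by
  rw [sampleLaw_eq_map]
  exact Measure.isProbabilityMeasure_map (Measurable.aemeasurable (by fun_prop))

theorem lintegral_sampleLaw (t : Vec d × Vec d) {g : Vec d × ℝ → ℝ≥0∞} (hg : Measurable g) :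
    ∫⁻ z, g z ∂(P.sampleLaw t) = ∫⁻ x, ∫⁻ e, g (x, inner ℝ t.2 x + e)
      ∂(gaussianReal 0 P.noiseVar) ∂(isoGaussian t.1 P.sigmaX) := by
  rw [sampleLaw_eq_map, lintegral_map hg (by fun_prop), lintegral_prod]
  exact (hg.comp (by fun_prop)).aemeasurable

theorem continuous_sampleDensity (t : Vec d × Vec d) : Continuous (P.sampleDensity t) := by
  unfold sampleDensity isoGaussianDensity gaussianPDFReal
  fun_prop

theorem sampleDensity_pos (t : Vec d × Vec d) (p : Vec d × ℝ) : 0 < P.sampleDensity t p :=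
  mul_pos (isoGaussianDensity_pos _ P.sigmaX_pos _) (gaussianPDFReal_pos _ _ _ P.noiseVar_ne_zero)

theorem sampleLaw_eq_withDensity (t : Vec d × Vec d) :
    P.sampleLaw t = volume.withDensity fun p => ENNReal.ofReal (P.sampleDensity t p) := by
  have hdens : Measurable fun p => ENNReal.ofReal (P.sampleDensity t p) :=
    (P.continuous_sampleDensity t).measurable.ennreal_ofReal
  have hx : Measurable fun x => ENNReal.ofReal (isoGaussianDensity t.1 P.sigmaX x) :=
    (continuous_isoGaussianDensity _ _).measurable.ennreal_ofReal
  refine Measure.ext_of_lintegral _ fun g hg => ?_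
  have hshift_meas : Measurable fun x => ∫⁻ e, g (x, inner ℝ t.2 x + e)
      ∂(gaussianReal 0 P.noiseVar) :=
    Measurable.lintegral_prod_right' (f := fun z : Vec d × ℝ => g (z.1, inner ℝ t.2 z.1 + z.2))
      (hg.comp (by fun_prop))
  rw [P.lintegral_sampleLaw t hg, lintegral_withDensity_eq_lintegral_mul _ hdens hg,
    Measure.volume_eq_prod, lintegral_prod _ (hdens.mul hg).aemeasurable,
    isoGaussian_eq_withDensity _ P.sigmaX_pos,
    lintegral_withDensity_eq_lintegral_mul _ hx hshift_meas]
  refine lintegral_congr fun x => ?_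
  have hgx : Measurable fun y => g (x, y) := hg.comp (by fun_prop)
  simp only [Pi.mul_apply, sampleDensity]
  rw [lintegral_const_add_gaussianReal _ P.noiseVar_ne_zero hgx,
    ← lintegral_const_mul _ (by fun_prop)]
  refine lintegral_congr fun y => ?_
  rw [ENNReal.ofReal_mul (isoGaussianDensity_pos _ P.sigmaX_pos _).le, mul_assoc]
  rfl

theorem likelihood_eq_prod_mul {k : ℕ} (q : Prompt d k) (t : Vec d × Vec d) : P.likelihood q t =
    (∏ i, P.sampleDensity t (q.1 i)) * isoGaussianDensity t.1 P.sigmaX q.2 := rfl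

theorem likelihood_pos {k : ℕ} (q : Prompt d k) (t : Vec d × Vec d) : 0 < P.likelihood q t :=
  mul_pos (Finset.prod_pos fun _ _ => P.sampleDensity_pos _ _)
    (isoGaussianDensity_pos _ P.sigmaX_pos _)

theorem exists_likelihood_le (k : ℕ) : ∃ c, ∀ (q : Prompt d k) t, P.likelihood q t ≤ c := by
  refine ⟨(∏ _i : Fin k, (Real.sqrt (2 * Real.pi * P.sigmaX ^ 2))⁻¹ ^ d
    * (Real.sqrt (2 * Real.pi * P.noiseVar))⁻¹)
    * (Real.sqrt (2 * Real.pi * P.sigmaX ^ 2))⁻¹ ^ d, fun q t => ?_⟩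
  rw [likelihood_eq_prod_mul]
  gcongr with i
  · exact (isoGaussianDensity_pos _ P.sigmaX_pos _).le
  · exact fun i _ => (P.sampleDensity_pos _ _).le
  · exact mul_le_mul (isoGaussianDensity_le _ _ _) (gaussianPDFReal_le _ _ _)
      (gaussianPDFReal_nonneg _ _ _) (by positivity)
  · exact isoGaussianDensity_le _ _ _

@[fun_prop]
theorem continuous_likelihood {α : Type*} [TopologicalSpace α] {k : ℕ} {q : α → Prompt d k}
    {t : α → Vec d × Vec d} (hq : Continuous q) (ht : Continuous t) :
    Continuous fun a => P.likelihood (q a) (t a) := by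
  unfold likelihood isoGaussianDensity gaussianPDFReal
  fun_prop

theorem promptLaw_eq_withDensity (k : ℕ) (t : Vec d × Vec d) :
    P.promptLaw k t = volume.withDensity fun q => ENNReal.ofReal (P.likelihood q t) := by
  have hdens : Measurable fun p => ENNReal.ofReal (P.sampleDensity t p) :=
    (P.continuous_sampleDensity t).measurable.ennreal_ofReal
  have hx : Measurable fun x => ENNReal.ofReal (isoGaussianDensity t.1 P.sigmaX x) :=
    (continuous_isoGaussianDensity _ _).measurable.ennreal_ofReal
  have : IsProbabilityMeasure
      (volume.withDensity fun p => ENNReal.ofReal (P.sampleDensity t p)) := by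
    rw [← sampleLaw_eq_withDensity]
    infer_instance
  have hpi : (Measure.pi fun _ : Fin k => P.sampleLaw t)
      = volume.withDensity fun S => ∏ i, ENNReal.ofReal (P.sampleDensity t (S i)) := by
    simp_rw [sampleLaw_eq_withDensity]
    exact pi_withDensity _ fun _ => hdens
  have hprod : Measurable fun S : Fin k → Vec d × ℝ =>
      ∏ i, ENNReal.ofReal (P.sampleDensity t (S i)) :=
    Finset.measurable_fun_prod _ fun i _ => hdens.comp (measurable_pi_apply i)
  have hpos (S : Fin k → Vec d × ℝ) (i : Fin k) : 0 ≤ P.sampleDensity t (S i) :=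
    (P.sampleDensity_pos _ _).le
  rw [promptLaw, hpi, isoGaussian_eq_withDensity _ P.sigmaX_pos, prod_withDensity hprod hx]
  refine congrArg _ (funext fun q => ?_)
  rw [likelihood_eq_prod_mul, ENNReal.ofReal_mul (Finset.prod_nonneg fun i _ => hpos q.1 i),
    ENNReal.ofReal_prod_of_nonneg fun i _ => hpos q.1 i]

theorem lintegral_promptLaw (k : ℕ) (t : Vec d × Vec d) {g : Prompt d k → ℝ≥0∞}
    (hg : Measurable g) :
    ∫⁻ q, g q ∂(P.promptLaw k t) = ∫⁻ q, ENNReal.ofReal (P.likelihood q t) * g q := by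
  rw [promptLaw_eq_withDensity, lintegral_withDensity_eq_lintegral_mul _
    (P.continuous_likelihood continuous_id' continuous_const).measurable.ennreal_ofReal hg]
  rfl

theorem measurable_lintegral_promptLaw (k : ℕ) {g : (Vec d × Vec d) → Prompt d k → ℝ≥0∞}
    (hg : Measurable (Function.uncurry g)) :
    Measurable fun t => ∫⁻ q, g t q ∂(P.promptLaw k t) := by
  simp_rw [fun t => P.lintegral_promptLaw k t (hg.of_uncurry_left (x := t))]
  exact ((P.continuous_likelihood continuous_snd continuous_fst).measurable.ennreal_ofReal.mul
    hg).lintegral_prod_right'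

end Densities

section Prior

instance isProbabilityMeasure_prior : IsProbabilityMeasure P.prior where
  measure_univ := by
    simp only [prior, Measure.coe_finsetSum, Finset.sum_apply, Measure.smul_apply, measure_univ,
      smul_eq_mul, mul_one]
    rw [← ENNReal.ofReal_sum_of_nonneg fun m _ => (P.weight_pos m).le, P.weight_sum,
      ENNReal.ofReal_one]

theorem integrable_prior_iff {E : Type*} [NormedAddCommGroup E] {g : Vec d × Vec d → E} :
    Integrable g P.prior ↔ ∀ m, Integrable g
      ((isoGaussian (P.muCenter m) P.sigmaMu).prod (isoGaussian (P.wCenter m) P.sigmaW)) := by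
  simp only [prior, integrable_finsetSum_measure, Finset.mem_univ, true_implies]
  refine forall_congr' fun m => ?_
  rw [integrable_smul_measure (by simpa using P.weight_pos m) ENNReal.ofReal_ne_top]

theorem integral_prior {g : Vec d × Vec d → ℝ} (hg : Integrable g P.prior) :
    ∫ t, g t ∂P.prior = ∑ m, P.weight m * ∫ t, g t
      ∂((isoGaussian (P.muCenter m) P.sigmaMu).prod (isoGaussian (P.wCenter m) P.sigmaW)) := by
  rw [prior, integral_finsetSum_measure fun m _ =>
    (P.integrable_prior_iff.1 hg m).smul_measure ENNReal.ofReal_ne_top]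
  refine Finset.sum_congr rfl fun m _ => ?_
  rw [integral_smul_measure, ENNReal.toReal_ofReal (P.weight_pos m).le, smul_eq_mul]

theorem memLp_snd_prior : MemLp (fun t : Vec d × Vec d => t.2) 2 P.prior := by
  rw [← integrable_norm_rpow_iff (by fun_prop) two_ne_zero ENNReal.ofNat_ne_top,
    integrable_prior_iff]
  intro m
  refine Integrable.comp_snd (f := fun w : Vec d => ‖w‖ ^ (2 : ℝ≥0∞).toReal) ?_ _
  simpa using integrable_norm_sq_isoGaussian (P.wCenter m) P.sigmaW

theorem integrable_snd_prior : Integrable (fun t : Vec d × Vec d => t.2) P.prior :=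
  P.memLp_snd_prior.integrable (by norm_num)

theorem integrable_likelihood_smul {E : Type*} [NormedAddCommGroup E] [NormedSpace ℝ E]
    {k : ℕ} (q : Prompt d k) {g : Vec d × Vec d → E} (hg : Integrable g P.prior) :
    Integrable (fun t => P.likelihood q t • g t) P.prior := by
  obtain ⟨c, hc⟩ := P.exists_likelihood_le k
  have hcont : Continuous (P.likelihood q) := P.continuous_likelihood continuous_const continuous_id
  refine hg.bdd_smul c hcont.aestronglyMeasurable (.of_forall fun t => ?_)
  rw [Real.norm_of_nonneg (P.likelihood_pos q t).le]
  exact hc q t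

theorem integrable_likelihood {k : ℕ} (q : Prompt d k) : Integrable (P.likelihood q) P.prior := by
  simpa using P.integrable_likelihood_smul q (integrable_const (1 : ℝ))

theorem integrable_likelihood_mul_inner {k : ℕ} (q : Prompt d k) (x : Vec d) :
    Integrable (fun t => P.likelihood q t * inner ℝ t.2 x) P.prior :=
  P.integrable_likelihood_smul q (P.integrable_snd_prior.inner_const x)

theorem integrable_likelihood_mul_inner_sq {k : ℕ} (q : Prompt d k) (x : Vec d) :
    Integrable (fun t => P.likelihood q t * (inner ℝ t.2 x : ℝ) ^ 2) P.prior :=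
  P.integrable_likelihood_smul q (P.memLp_snd_prior.inner_const x).integrable_sq

theorem evidence_pos {k : ℕ} (q : Prompt d k) : 0 < P.evidence q := by
  rw [evidence, integral_pos_iff_support_of_nonneg (fun t => (P.likelihood_pos q t).le)
    (P.integrable_likelihood q), show Function.support (P.likelihood q) = Set.univ from
    Set.eq_univ_of_forall fun t => (P.likelihood_pos q t).ne']
  simp

theorem continuous_integral_likelihood_smul (k : ℕ) {E : Type*} [NormedAddCommGroup E]
    [NormedSpace ℝ E] {g : Vec d × Vec d → E} (hg : Integrable g P.prior) :
    Continuous fun q : Prompt d k => ∫ t, P.likelihood q t • g t ∂P.prior := by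
  obtain ⟨c, hc⟩ := P.exists_likelihood_le k
  refine continuous_of_dominated (bound := fun t => c * ‖g t‖)
    (fun q => (P.integrable_likelihood_smul q hg).aestronglyMeasurable)
    (fun q => .of_forall fun t => ?_) (hg.norm.const_mul c)
    (.of_forall fun t => by fun_prop)
  rw [norm_smul, Real.norm_of_nonneg (P.likelihood_pos q t).le]
  exact mul_le_mul_of_nonneg_right (hc q t) (norm_nonneg _)

theorem continuous_evidence (k : ℕ) : Continuous (P.evidence : Prompt d k → ℝ) :=
  (P.continuous_integral_likelihood_smul k (integrable_const (1 : ℝ))).congr fun q => by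
    simp [evidence]

theorem continuous_bayesPredictor (k : ℕ) : Continuous (P.bayesPredictor k) := by
  have hnum (q : Prompt d k) : ∫ t, P.likelihood q t * inner ℝ t.2 q.2 ∂P.prior
      = inner ℝ q.2 (∫ t, P.likelihood q t • t.2 ∂P.prior) := by
    rw [← integral_inner (P.integrable_likelihood_smul q P.integrable_snd_prior)]
    simp_rw [inner_smul_right, real_inner_comm]
  unfold bayesPredictor
  simp_rw [hnum]
  exact (continuous_snd.inner (P.continuous_integral_likelihood_smul k P.integrable_snd_prior)).div
    (P.continuous_evidence k) fun q => (P.evidence_pos q).ne'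

end Prior

section Optimality

theorem lintegral_sq_loss {K : ℕ} (k : Fin K) {f : Prompt d k → ℝ} (hf : Measurable f)
    (t : Vec d × Vec d) :
    ∫⁻ S : Fin K → Vec d × ℝ,
        ENNReal.ofReal ((f (fun i => S (Fin.castLE k.isLt.le i), (S k).1) - (S k).2) ^ 2)
        ∂(Measure.pi fun _ => P.sampleLaw t)
      = (∫⁻ q, ENNReal.ofReal ((f q - inner ℝ t.2 q.2) ^ 2) ∂(P.promptLaw k t))
        + ENNReal.ofReal (P.sigmaY ^ 2) := by
  let loss (z : (Fin k → Vec d × ℝ) × (Vec d × ℝ)) : ℝ≥0∞ :=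
    ENNReal.ofReal ((f (z.1, z.2.1) - z.2.2) ^ 2)
  have hloss : Measurable loss := by fun_prop
  have hsplit := measurePreserving_comp_injective_prodMk_eval (fun _ : Fin K => P.sampleLaw t)
    (Fin.castLE_injective k.isLt.le) fun i => ne_of_lt (show Fin.castLE k.isLt.le i < k from i.isLt)
  have hnoise (S : Fin k → Vec d × ℝ) (x : Vec d) :
      ∫⁻ e, loss (S, (x, inner ℝ t.2 x + e)) ∂(gaussianReal 0 P.noiseVar)
        = ENNReal.ofReal ((f (S, x) - inner ℝ t.2 x) ^ 2) + ENNReal.ofReal (P.sigmaY ^ 2) := by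
    simp only [loss, ← sub_sub]
    rw [lintegral_sub_sq_gaussianReal, coe_noiseVar]
  have hsample (S : Fin k → Vec d × ℝ) : ∫⁻ z, loss (S, z) ∂(P.sampleLaw t)
      = (∫⁻ x, ENNReal.ofReal ((f (S, x) - inner ℝ t.2 x) ^ 2) ∂(isoGaussian t.1 P.sigmaX))
        + ENNReal.ofReal (P.sigmaY ^ 2) := by
    rw [P.lintegral_sampleLaw t (g := fun z => loss (S, z)) (by fun_prop)]
    simp_rw [hnoise]
    rw [lintegral_add_right _ measurable_const]
    simp
  calc ∫⁻ S : Fin K → Vec d × ℝ,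
        ENNReal.ofReal ((f (fun i => S (Fin.castLE k.isLt.le i), (S k).1) - (S k).2) ^ 2)
        ∂(Measure.pi fun _ => P.sampleLaw t)
      = ∫⁻ S, ∫⁻ z, loss (S, z) ∂(P.sampleLaw t) ∂(Measure.pi fun _ => P.sampleLaw t) :=
        (hsplit.lintegral_comp hloss).trans (lintegral_prod _ hloss.aemeasurable)
    _ = _ := by
        simp_rw [hsample]
        rw [lintegral_add_right _ measurable_const, promptLaw, lintegral_prod _ (by fun_prop)]
        simp

theorem measurable_lintegral_sq_error {k : ℕ} {f : Prompt d k → ℝ} (hf : Measurable f) :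
    Measurable fun t : Vec d × Vec d =>
      ∫⁻ q, ENNReal.ofReal ((f q - inner ℝ t.2 q.2) ^ 2) ∂(P.promptLaw k t) :=
  P.measurable_lintegral_promptLaw k
    (g := fun t q => ENNReal.ofReal ((f q - inner ℝ t.2 q.2) ^ 2)) (by fun_prop)

theorem pretrainRisk_eq_mul_sum_estimationRisk {K : ℕ} {F : Predictor d K}
    (hF : ∀ k, Measurable (F k)) :
    P.pretrainRisk K F = ENNReal.ofReal (1 / (K : ℝ)) *
      ∑ k : Fin K, (P.estimationRisk k (F k) + ENNReal.ofReal (P.sigmaY ^ 2)) := by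
  have hmeas (k : Fin K) : Measurable fun S : Fin K → Vec d × ℝ =>
      ENNReal.ofReal ((F k (fun i => S (Fin.castLE k.isLt.le i), (S k).1) - (S k).2) ^ 2) := by
    have := (hF k).comp (by fun_prop : Measurable fun S : Fin K → Vec d × ℝ =>
      ((fun i => S (Fin.castLE k.isLt.le i), (S k).1) : Prompt d k))
    fun_prop
  have htask (t : Vec d × Vec d) : ∫⁻ S : Fin K → Vec d × ℝ, ENNReal.ofReal ((1 / (K : ℝ)) *
      ∑ k : Fin K, (F k (fun i => S (Fin.castLE k.isLt.le i), (S k).1) - (S k).2) ^ 2)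
      ∂(Measure.pi fun _ => P.sampleLaw t)
      = ENNReal.ofReal (1 / (K : ℝ)) * ∑ k : Fin K,
        ((∫⁻ q, ENNReal.ofReal ((F k q - inner ℝ t.2 q.2) ^ 2) ∂(P.promptLaw k t))
        + ENNReal.ofReal (P.sigmaY ^ 2)) := by
    simp_rw [ENNReal.ofReal_mul (show 0 ≤ 1 / (K : ℝ) by positivity),
      ENNReal.ofReal_sum_of_nonneg fun (k : Fin K) (_ : k ∈ Finset.univ) => sq_nonneg _]
    rw [lintegral_const_mul _ (Finset.measurable_fun_sum _ fun k _ => hmeas k),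
      lintegral_finsetSum _ fun k _ => hmeas k]
    simp_rw [P.lintegral_sq_loss _ (hF _)]
  have herror (k : Fin K) := (P.measurable_lintegral_sq_error (hF k)).add_const
    (ENNReal.ofReal (P.sigmaY ^ 2))
  simp_rw [pretrainRisk, htask]
  rw [lintegral_const_mul _ (Finset.measurable_fun_sum _ fun k _ => herror k),
    lintegral_finsetSum _ fun k _ => herror k]
  simp_rw [lintegral_add_right _ measurable_const]
  simp [estimationRisk]

theorem estimationRisk_eq_lintegral (k : ℕ) {f : Prompt d k → ℝ} (hf : Measurable f) :
    P.estimationRisk k f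
      = ∫⁻ q, ENNReal.ofReal (∫ t, P.likelihood q t * (f q - inner ℝ t.2 q.2) ^ 2 ∂P.prior) := by
  have hint (q : Prompt d k) :
      Integrable (fun t => P.likelihood q t * (f q - inner ℝ t.2 q.2) ^ 2) P.prior :=
    P.integrable_likelihood_smul q
      ((memLp_const (f q)).sub (P.memLp_snd_prior.inner_const q.2)).integrable_sq
  have hjoint : Measurable fun z : (Vec d × Vec d) × Prompt d k =>
      ENNReal.ofReal (P.likelihood z.2 z.1 * (f z.2 - inner ℝ z.1.2 z.2.2) ^ 2) := by
    have := (P.continuous_likelihood (k := k) continuous_snd continuous_fst).measurable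
    fun_prop
  calc P.estimationRisk k f
      = ∫⁻ t, ∫⁻ q, ENNReal.ofReal (P.likelihood q t * (f q - inner ℝ t.2 q.2) ^ 2)
          ∂volume ∂P.prior := by
        refine lintegral_congr fun t => ?_
        rw [lintegral_promptLaw _ _ _ (by fun_prop)]
        simp_rw [ENNReal.ofReal_mul (P.likelihood_pos _ t).le]
    _ = ∫⁻ q, ∫⁻ t, ENNReal.ofReal (P.likelihood q t * (f q - inner ℝ t.2 q.2) ^ 2)
          ∂P.prior := lintegral_lintegral_swap hjoint.aemeasurable
    _ = _ := lintegral_congr fun q => (ofReal_integral_eq_lintegral_ofReal (hint q)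
        (.of_forall fun t => mul_nonneg (P.likelihood_pos q t).le (sq_nonneg _))).symm

theorem measurable_sq_sub_bayesPredictor {k : ℕ} {f : Prompt d k → ℝ} (hf : Measurable f) :
    Measurable fun q => ENNReal.ofReal (P.evidence q * (f q - P.bayesPredictor k q) ^ 2) := by
  have := (P.continuous_evidence k).measurable
  have := (P.continuous_bayesPredictor k).measurable
  fun_prop

theorem estimationRisk_eq_add_excessRisk (k : ℕ) {f : Prompt d k → ℝ} (hf : Measurable f) :
    P.estimationRisk k f = P.estimationRisk k (P.bayesPredictor k) + P.excessRisk k f := by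
  rw [P.estimationRisk_eq_lintegral k hf,
    P.estimationRisk_eq_lintegral k (P.continuous_bayesPredictor k).measurable, excessRisk,
    ← lintegral_add_right _ (P.measurable_sq_sub_bayesPredictor hf)]
  refine lintegral_congr fun q => ?_
  rw [integral_mul_sub_sq (P.integrable_likelihood q) (P.integrable_likelihood_mul_inner q q.2)
    (P.integrable_likelihood_mul_inner_sq q q.2) (P.evidence_pos q).ne' (f q), add_comm]
  exact ENNReal.ofReal_add
    (integral_nonneg fun t => mul_nonneg (P.likelihood_pos q t).le (sq_nonneg _))
    (mul_nonneg (P.evidence_pos q).le (sq_nonneg _))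

theorem pretrainRisk_eq_add_excessRisk {K : ℕ} {F : Predictor d K} (hF : ∀ k, Measurable (F k)) :
    P.pretrainRisk K F = P.pretrainRisk K (fun k => P.bayesPredictor k)
      + ENNReal.ofReal (1 / (K : ℝ)) * ∑ k : Fin K, P.excessRisk k (F k) := by
  rw [P.pretrainRisk_eq_mul_sum_estimationRisk hF,
    P.pretrainRisk_eq_mul_sum_estimationRisk fun k => (P.continuous_bayesPredictor k).measurable,
    ← mul_add, ← Finset.sum_add_distrib]
  simp_rw [fun k : Fin K => P.estimationRisk_eq_add_excessRisk k (hF k), add_right_comm]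

theorem isOptimal_bayesPredictor (K : ℕ) : P.IsOptimal K (fun k => P.bayesPredictor k) :=
  ⟨fun k => (P.continuous_bayesPredictor k).measurable, fun _ hG =>
    le_self_add.trans (P.pretrainRisk_eq_add_excessRisk hG).ge⟩

theorem lintegral_inner_sq_promptLaw_le (k : ℕ) (t : Vec d × Vec d) :
    ∫⁻ q, ENNReal.ofReal ((inner ℝ t.2 q.2) ^ 2) ∂(P.promptLaw k t)
      ≤ ENNReal.ofReal (‖t.2‖ ^ 2 * (‖t.1‖ ^ 2 + d * P.sigmaX ^ 2)) := by
  have hsnd : MeasurePreserving Prod.snd (P.promptLaw k t) (isoGaussian t.1 P.sigmaX) :=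
    measurePreserving_snd
  calc ∫⁻ q, ENNReal.ofReal ((inner ℝ t.2 q.2) ^ 2) ∂(P.promptLaw k t)
      ≤ ∫⁻ q, ENNReal.ofReal (‖t.2‖ ^ 2) * ENNReal.ofReal (‖q.2‖ ^ 2) ∂(P.promptLaw k t) := by
        refine lintegral_mono fun q => ?_
        rw [← ENNReal.ofReal_mul (sq_nonneg _), ← mul_pow, ← sq_abs (inner ℝ t.2 q.2)]
        gcongr
        exact abs_real_inner_le_norm _ _
    _ = ENNReal.ofReal (‖t.2‖ ^ 2 * (‖t.1‖ ^ 2 + d * P.sigmaX ^ 2)) := by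
        rw [lintegral_const_mul _ (by fun_prop), ENNReal.ofReal_mul (sq_nonneg _),
          ← lintegral_norm_sq_isoGaussian, ← hsnd.lintegral_comp (by fun_prop)]

theorem estimationRisk_zero_ne_top (k : ℕ) : P.estimationRisk k (fun _ => 0) ≠ ∞ := by
  have hint : Integrable (fun t : Vec d × Vec d => ‖t.2‖ ^ 2 * (‖t.1‖ ^ 2 + d * P.sigmaX ^ 2))
      P.prior := by
    refine P.integrable_prior_iff.2 fun m => ?_
    simpa [mul_comm] using Integrable.mul_prod ((integrable_norm_sq_isoGaussian (P.muCenter m)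
      P.sigmaMu).add (integrable_const ((d : ℝ) * P.sigmaX ^ 2)))
      (integrable_norm_sq_isoGaussian (P.wCenter m) P.sigmaW)
  simp only [estimationRisk, zero_sub, neg_sq]
  exact ((lintegral_mono (P.lintegral_inner_sq_promptLaw_le k)).trans_lt hint.lintegral_lt_top).ne

theorem estimationRisk_bayesPredictor_ne_top (k : ℕ) :
    P.estimationRisk k (P.bayesPredictor k) ≠ ∞ :=
  ne_top_of_le_ne_top (P.estimationRisk_zero_ne_top k)
    (le_self_add.trans (P.estimationRisk_eq_add_excessRisk k measurable_const).ge)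

theorem pretrainRisk_bayesPredictor_ne_top (K : ℕ) :
    P.pretrainRisk K (fun k => P.bayesPredictor k) ≠ ∞ := by
  rw [P.pretrainRisk_eq_mul_sum_estimationRisk fun k => (P.continuous_bayesPredictor k).measurable]
  exact ENNReal.mul_ne_top ENNReal.ofReal_ne_top (ENNReal.sum_ne_top.2 fun k _ =>
    ENNReal.add_ne_top.2 ⟨P.estimationRisk_bayesPredictor_ne_top k, ENNReal.ofReal_ne_top⟩)

theorem excessRisk_eq_zero_of_isOptimal {K : ℕ} {F : Predictor d K} (hF : P.IsOptimal K F)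
    (k : Fin K) : P.excessRisk k (F k) = 0 := by
  have hle := hF.2 _ (P.isOptimal_bayesPredictor K).1
  rw [P.pretrainRisk_eq_add_excessRisk hF.1] at hle
  have hmul := nonpos_iff_eq_zero.1 ((ENNReal.add_le_add_iff_left
    (P.pretrainRisk_bayesPredictor_ne_top K)).1 (hle.trans_eq (add_zero _).symm))
  have hsum := (mul_eq_zero.1 hmul).resolve_left (by simpa using k.pos.ne')
  exact Finset.sum_eq_zero_iff.1 hsum k (Finset.mem_univ k)

theorem eq_bayesPredictor_of_isOptimal {K : ℕ} {F : Predictor d K} (hF : P.IsOptimal K F)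
    {k : Fin K} (hk : Continuous (F k)) : F k = P.bayesPredictor k := by
  refine Measure.eq_of_ae_eq (μ := volume) ?_ hk (P.continuous_bayesPredictor k)
  filter_upwards [(lintegral_eq_zero_iff (P.measurable_sq_sub_bayesPredictor (hF.1 k))).1
    (P.excessRisk_eq_zero_of_isOptimal hF k)] with q hq
  have hsq : (F k q - P.bayesPredictor k q) ^ 2 ≤ 0 :=
    nonpos_of_mul_nonpos_right (ENNReal.ofReal_eq_zero.1 hq) (P.evidence_pos q)
  exact sub_eq_zero.1 (pow_eq_zero_iff two_ne_zero |>.1 (hsq.antisymm (sq_nonneg _)))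

end Optimality

end PretrainModel

section Ridge

variable {V ι : Type*} [NormedAddCommGroup V] [InnerProductSpace ℝ V] [Fintype ι]

/-- The operator `I + δ ∑ᵢ xᵢ xᵢᵀ` of the normal equations of ridge regression on the inputs `X`. -/
def ridgeOperator (δ : ℝ) (X : ι → V) : V →ₗ[ℝ] V :=
  LinearMap.id + δ • ∑ i, (innerₛₗ ℝ (X i)).smulRight (X i)

theorem ridgeOperator_apply (δ : ℝ) (X : ι → V) (v : V) :
    ridgeOperator δ X v = v + δ • ∑ i, inner ℝ (X i) v • X i := by
  simp [ridgeOperator]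

theorem inner_ridgeOperator_self (δ : ℝ) (X : ι → V) (v : V) :
    inner ℝ v (ridgeOperator δ X v) = ‖v‖ ^ 2 + δ * ∑ i, inner ℝ (X i) v ^ 2 := by
  rw [ridgeOperator_apply, inner_add_right, inner_smul_right, inner_sum, real_inner_self_eq_norm_sq]
  simp_rw [inner_smul_right, real_inner_comm, pow_two]

theorem mul_norm_le_norm_ridgeOperator {δ l : ℝ} (hδ : 0 ≤ δ) {X : ι → V} {v : V}
    (hX : l * ‖v‖ ^ 2 ≤ ∑ i, inner ℝ (X i) v ^ 2) :
    (1 + δ * l) * ‖v‖ ≤ ‖ridgeOperator δ X v‖ := by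
  rcases (norm_nonneg v).eq_or_lt with hv | hv
  · rw [← hv, mul_zero]
    exact norm_nonneg _
  refine le_of_mul_le_mul_left ?_ hv
  calc ‖v‖ * ((1 + δ * l) * ‖v‖) = ‖v‖ ^ 2 + δ * (l * ‖v‖ ^ 2) := by ring
    _ ≤ ‖v‖ ^ 2 + δ * ∑ i, inner ℝ (X i) v ^ 2 := by gcongr
    _ = inner ℝ v (ridgeOperator δ X v) := (inner_ridgeOperator_self δ X v).symm
    _ ≤ ‖v‖ * ‖ridgeOperator δ X v‖ := real_inner_le_norm _ _

theorem ridgeOperator_surjective [FiniteDimensional ℝ V] {δ : ℝ} (hδ : 0 ≤ δ) (X : ι → V) :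
    Function.Surjective (ridgeOperator δ X) := by
  refine LinearMap.injective_iff_surjective.1 ((injective_iff_map_eq_zero _).2 fun v hv => ?_)
  have := mul_norm_le_norm_ridgeOperator hδ (X := X) (v := v) (l := 0)
    (by rw [zero_mul]; positivity)
  simpa [hv] using this

/-- The ridge regression loss with prior center `c`. Up to an additive constant it is the negative
log-density of the posterior of `w` under the prior `N(c, a² I)` and label noise `N(0, b²)`. -/
def ridgeLoss (a b : ℝ) (c : V) (X : ι → V) (y : ι → ℝ) (w : V) : ℝ :=
  ‖w - c‖ ^ 2 / (2 * a ^ 2) + ∑ i, (y i - inner ℝ w (X i)) ^ 2 / (2 * b ^ 2)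

theorem ridgeLoss_add {a b : ℝ} (ha : a ≠ 0) {c u : V} {X : ι → V} {y : ι → ℝ}
    (hu : ridgeOperator (a ^ 2 / b ^ 2) X u = c + (a ^ 2 / b ^ 2) • ∑ i, y i • X i) (h : V) :
    ridgeLoss a b c X y (u + h) = ridgeLoss a b c X y u
      + (‖h‖ ^ 2 / (2 * a ^ 2) + ∑ i, inner ℝ h (X i) ^ 2 / (2 * b ^ 2)) := by
  have hres : u - c = (a ^ 2 / b ^ 2) • ∑ i, (y i - inner ℝ u (X i)) • X i := by
    simp only [sub_smul, Finset.sum_sub_distrib, smul_sub, ← real_inner_comm u]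
    rw [sub_eq_sub_iff_add_eq_add, ← ridgeOperator_apply, hu, add_comm]
  have hcross : inner ℝ (u - c) h / a ^ 2
      = ∑ i, (y i - inner ℝ u (X i)) * inner ℝ h (X i) / b ^ 2 := by
    rw [hres, real_inner_smul_left, sum_inner, ← Finset.sum_div]
    simp_rw [real_inner_smul_left, real_inner_comm h]
    field_simp
  have hlabel (i : ι) : (y i - inner ℝ (u + h) (X i)) ^ 2 / (2 * b ^ 2)
      = (y i - inner ℝ u (X i)) ^ 2 / (2 * b ^ 2) + inner ℝ h (X i) ^ 2 / (2 * b ^ 2)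
        - (y i - inner ℝ u (X i)) * inner ℝ h (X i) / b ^ 2 := by
    rw [inner_add_left, ← sub_sub, sub_sq]
    ring
  simp only [ridgeLoss, hlabel, add_sub_right_comm u h c, norm_add_sq_real, Finset.sum_add_distrib,
    Finset.sum_sub_distrib, ← hcross]
  ring

theorem ridgeLoss_reflect {a b : ℝ} (ha : a ≠ 0) {c u : V} {X : ι → V} {y : ι → ℝ}
    (hu : ridgeOperator (a ^ 2 / b ^ 2) X u = c + (a ^ 2 / b ^ 2) • ∑ i, y i • X i) (h : V) :
    ridgeLoss a b c X y (u - h) = ridgeLoss a b c X y (u + h) := by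
  rw [sub_eq_add_neg, ridgeLoss_add ha hu, ridgeLoss_add ha hu]
  simp only [norm_neg, inner_neg_left, even_two.neg_pow]

theorem ridgeOperator_sub_of_noiseless {δ : ℝ} {X : ι → V} {c u w : V}
    (hu : ridgeOperator δ X u = c + δ • ∑ i, inner ℝ (X i) w • X i) :
    ridgeOperator δ X (u - w) = c - w := by
  rw [map_sub, hu, ridgeOperator_apply]
  abel

end Ridge

theorem integral_eq_zero_of_odd_about {G : Type*} [MeasurableSpace G] [AddCommGroup G]
    [MeasurableAdd G] [MeasurableNeg G] {μ : Measure G} [μ.IsNegInvariant] [μ.IsAddLeftInvariant]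
    {g : G → ℝ} (c : G) (hg : ∀ h, g (c - h) = -g (c + h)) : ∫ w, g w ∂μ = 0 := by
  have hneg : ∫ h, g (c - h) ∂μ = -∫ h, g (c + h) ∂μ := by
    simp_rw [hg, integral_neg]
  rw [integral_sub_left_eq_self g μ c, integral_add_left_eq_self g c] at hneg
  linarith

namespace PretrainModel

variable {d M : ℕ} (P : PretrainModel d M)

theorem deltaW_pos : 0 < P.deltaW :=
  div_pos (pow_pos P.sigmaW_pos 2) (pow_pos P.sigmaY_pos 2)

/-- The factor of the likelihood that depends on the task mean `μ`. -/
def inputLikelihood {k : ℕ} (q : Prompt d k) (μ : Vec d) : ℝ :=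
  (∏ i, isoGaussianDensity μ P.sigmaX (q.1 i).1) * isoGaussianDensity μ P.sigmaX q.2

/-- The factor of the likelihood that depends on the task weight `w`. -/
def labelLikelihood {k : ℕ} (q : Prompt d k) (w : Vec d) : ℝ :=
  ∏ i, gaussianPDFReal (inner ℝ w (q.1 i).1) P.noiseVar (q.1 i).2

theorem likelihood_eq_mul {k : ℕ} (q : Prompt d k) (t : Vec d × Vec d) :
    P.likelihood q t = P.inputLikelihood q t.1 * P.labelLikelihood q t.2 := by
  simp only [likelihood_eq_prod_mul, sampleDensity, inputLikelihood, labelLikelihood,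
    Finset.prod_mul_distrib]
  ring

/-- The normal equations of ridge regression on the labeled samples of `q`, with prior center `c`.
Their solution `u` is the posterior mean of `w` under the prior `N(c, σ_w² I)`. -/
def IsRidgeEstimate {k : ℕ} (q : Prompt d k) (c u : Vec d) : Prop :=
  ridgeOperator P.deltaW (fun i => (q.1 i).1) u = c + P.deltaW • ∑ i, (q.1 i).2 • (q.1 i).1

theorem exists_isRidgeEstimate {k : ℕ} (q : Prompt d k) (c : Vec d) :
    ∃ u, P.IsRidgeEstimate q c u :=
  ridgeOperator_surjective P.deltaW_pos.le _ _

theorem isoGaussianDensity_mul_labelLikelihood {k : ℕ} (q : Prompt d k) (c w : Vec d) :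
    isoGaussianDensity c P.sigmaW w * P.labelLikelihood q w
      = (Real.sqrt (2 * Real.pi * P.sigmaW ^ 2))⁻¹ ^ d
        * (Real.sqrt (2 * Real.pi * P.sigmaY ^ 2))⁻¹ ^ k
        * Real.exp
          (-ridgeLoss P.sigmaW P.sigmaY c (fun i => (q.1 i).1) (fun i => (q.1 i).2) w) := by
  simp only [isoGaussianDensity, labelLikelihood, gaussianPDFReal, coe_noiseVar,
    Finset.prod_mul_distrib, Finset.prod_const, Finset.card_univ, Fintype.card_fin, ← Real.exp_sum,
    ridgeLoss, neg_add, Real.exp_add, neg_div, Finset.sum_neg_distrib]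
  ring

theorem integral_labelLikelihood_mul_inner_sub {k : ℕ} {q : Prompt d k} {c u : Vec d}
    (hu : P.IsRidgeEstimate q c u) (z : Vec d) :
    ∫ w, P.labelLikelihood q w * inner ℝ (w - u) z ∂(isoGaussian c P.sigmaW) = 0 := by
  have hdens : Measurable fun w => ENNReal.ofReal (isoGaussianDensity c P.sigmaW w) :=
    (continuous_isoGaussianDensity _ _).measurable.ennreal_ofReal
  have hpos (w : Vec d) : 0 ≤ isoGaussianDensity c P.sigmaW w :=
    (isoGaussianDensity_pos c P.sigmaW_pos w).le
  rw [isoGaussian_eq_withDensity _ P.sigmaW_pos, integral_withDensity_eq_integral_toReal_smul hdens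
    (.of_forall fun _ => ENNReal.ofReal_lt_top)]
  simp only [ENNReal.toReal_ofReal (hpos _), smul_eq_mul, ← mul_assoc,
    isoGaussianDensity_mul_labelLikelihood]
  refine integral_eq_zero_of_odd_about u fun h => ?_
  rw [ridgeLoss_reflect P.sigmaW_pos.ne' hu, sub_sub_cancel_left, add_sub_cancel_left,
    inner_neg_left, mul_neg]

theorem integral_likelihood_mul_inner {k : ℕ} {q : Prompt d k} {m : Fin M} {u : Vec d}
    (hu : P.IsRidgeEstimate q (P.wCenter m) u) (z : Vec d) :
    ∫ t, P.likelihood q t * inner ℝ t.2 z ∂((isoGaussian (P.muCenter m) P.sigmaMu).prod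
        (isoGaussian (P.wCenter m) P.sigmaW))
      = inner ℝ u z * ∫ t, P.likelihood q t ∂((isoGaussian (P.muCenter m) P.sigmaMu).prod
        (isoGaussian (P.wCenter m) P.sigmaW)) := by
  have hinner := P.integrable_prior_iff.1 (P.integrable_likelihood_mul_inner q z) m
  have hlik := P.integrable_prior_iff.1 (P.integrable_likelihood q) m
  rw [← integral_const_mul, ← sub_eq_zero, ← integral_sub hinner (hlik.const_mul _)]
  calc ∫ t, (P.likelihood q t * inner ℝ t.2 z - inner ℝ u z * P.likelihood q t)
        ∂((isoGaussian (P.muCenter m) P.sigmaMu).prod (isoGaussian (P.wCenter m) P.sigmaW))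
      = ∫ t, P.inputLikelihood q t.1 * (P.labelLikelihood q t.2 * inner ℝ (t.2 - u) z)
        ∂((isoGaussian (P.muCenter m) P.sigmaMu).prod (isoGaussian (P.wCenter m) P.sigmaW)) := by
        congr with t
        rw [likelihood_eq_mul, inner_sub_left]
        ring
    _ = 0 := by
        rw [integral_prod_mul (P.inputLikelihood q)
          fun w => P.labelLikelihood q w * inner ℝ (w - u) z,
          P.integral_labelLikelihood_mul_inner_sub hu, mul_zero]

theorem abs_bayesPredictor_sub_le {k : ℕ} {q : Prompt d k} {u : Fin M → Vec d}
    (hu : ∀ m, P.IsRidgeEstimate q (P.wCenter m) (u m)) {c r : ℝ}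
    (hc : ∀ m, |inner ℝ (u m) q.2 - c| ≤ r) : |P.bayesPredictor k q - c| ≤ r := by
  let Z (m : Fin M) : ℝ := P.weight m * ∫ t, P.likelihood q t
    ∂((isoGaussian (P.muCenter m) P.sigmaMu).prod (isoGaussian (P.wCenter m) P.sigmaW))
  have hZ (m : Fin M) : 0 ≤ Z m :=
    mul_nonneg (P.weight_pos m).le (integral_nonneg fun t => (P.likelihood_pos q t).le)
  have hden : P.evidence q = ∑ m, Z m := P.integral_prior (P.integrable_likelihood q)
  have hnum : ∫ t, P.likelihood q t * inner ℝ t.2 q.2 ∂P.prior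
      = ∑ m, inner ℝ (u m) q.2 * Z m := by
    rw [P.integral_prior (P.integrable_likelihood_mul_inner q q.2)]
    simp_rw [P.integral_likelihood_mul_inner (hu _), Z, mul_left_comm]
  have hsub : P.bayesPredictor k q - c
      = (∑ m, (inner ℝ (u m) q.2 - c) * Z m) / P.evidence q := by
    rw [eq_div_iff (P.evidence_pos q).ne', sub_mul, bayesPredictor, ← evidence,
      div_mul_cancel₀ _ (P.evidence_pos q).ne', hnum, hden, Finset.mul_sum,
      ← Finset.sum_sub_distrib]
    simp_rw [sub_mul]
  rw [hsub, abs_div, abs_of_pos (P.evidence_pos q), div_le_iff₀ (P.evidence_pos q), hden,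
    Finset.mul_sum]
  refine (Finset.abs_sum_le_sum_abs _ _).trans (Finset.sum_le_sum fun m _ => ?_)
  rw [abs_mul, abs_of_nonneg (hZ m)]
  exact mul_le_mul_of_nonneg_right (hc m) (hZ m)

theorem abs_bayesPredictor_sub_inner_le {k : ℕ} (X : Fin k → Vec d) (x wStar : Vec d) {l : ℝ}
    (hl : 0 ≤ l) (hX : ∀ v, l * ‖v‖ ^ 2 ≤ ∑ i, inner ℝ (X i) v ^ 2) :
    |P.bayesPredictor k (fun i => (X i, inner ℝ (X i) wStar), x) - inner ℝ x wStar|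
      ≤ (1 + ‖wStar‖) / (1 + P.deltaW * l) * ‖x‖ := by
  have hδ := P.deltaW_pos
  choose u hu using fun m =>
    P.exists_isRidgeEstimate (fun i => (X i, inner ℝ (X i) wStar), x) (P.wCenter m)
  refine P.abs_bayesPredictor_sub_le hu fun m => ?_
  rw [real_inner_comm wStar x, ← inner_sub_left]
  refine (abs_real_inner_le_norm _ _).trans ?_
  gcongr
  rw [le_div_iff₀' (by positivity)]
  calc (1 + P.deltaW * l) * ‖u m - wStar‖
      ≤ ‖ridgeOperator P.deltaW X (u m - wStar)‖ :=
        mul_norm_le_norm_ridgeOperator hδ.le (hX _)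
    _ = ‖P.wCenter m - wStar‖ := by rw [ridgeOperator_sub_of_noiseless (hu m)]
    _ ≤ 1 + ‖wStar‖ := P.norm_wCenter m ▸ norm_sub_le _ _

end PretrainModel

section Concentration

open Filter Topology

variable {E : Type*} [MeasurableSpace E] {ν : Measure E} {Z : E → ℝ}

theorem zero_mem_interior_integrableExpSet_neg (h : 0 ∈ interior (integrableExpSet Z ν)) :
    0 ∈ interior (integrableExpSet (fun y => -Z y) ν) := by
  have hset : integrableExpSet (fun y => -Z y) ν = Neg.neg ⁻¹' integrableExpSet Z ν := by
    ext t
    simp [integrableExpSet]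
  rw [mem_interior_iff_mem_nhds] at h ⊢
  rw [hset]
  exact continuous_neg.continuousAt.preimage_mem_nhds (by rwa [neg_zero])

variable [IsProbabilityMeasure ν]

theorem integral_abs_sub_integral_le_sqrt_variance (hZ : MemLp Z 2 ν) :
    ∫ x, |Z x - ∫ y, Z y ∂ν| ∂ν ≤ √Var[Z; ν] := by
  have habs : MemLp (fun x => |Z x - ∫ y, Z y ∂ν|) 2 ν := (hZ.sub (memLp_const _)).abs
  refine Real.le_sqrt_of_sq_le ?_
  have hvar := variance_nonneg (fun x => |Z x - ∫ y, Z y ∂ν|) ν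
  rw [variance_eq_sub habs] at hvar
  simpa [variance_eq_integral hZ.aemeasurable] using hvar

theorem integral_sum_pi {k : ℕ} (hZ : Integrable Z ν) :
    ∫ x, ∑ i : Fin k, Z (x i) ∂(Measure.pi fun _ => ν) = k * ∫ y, Z y ∂ν := by
  rw [integral_finsetSum _ fun i _ => integrable_comp_eval hZ]
  have heval (i : Fin k) : ∫ x : Fin k → E, Z (x i) ∂(Measure.pi fun _ => ν) = ∫ y, Z y ∂ν :=
    integral_comp_eval (μ := fun _ => ν) hZ.aestronglyMeasurable
  simp [heval]

/-- The deviation of the sum of `Z` over a sample of size `k` from its expectation when the sample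
is drawn from `ν`. -/
def empiricalDeviation (ν : Measure E) (Z : E → ℝ) {k : ℕ} (x : Fin k → E) : ℝ :=
  ∑ i, Z (x i) - k * ∫ y, Z y ∂ν

theorem integrable_empiricalDeviation (hZ : Integrable Z ν) (k : ℕ) :
    Integrable (empiricalDeviation ν Z) (Measure.pi fun _ : Fin k => ν) :=
  (integrable_finsetSum _ fun _ _ => integrable_comp_eval hZ).sub (integrable_const _)

theorem integral_abs_empiricalDeviation_le (hZ : MemLp Z 2 ν) (k : ℕ) :
    ∫ x, |empiricalDeviation ν Z x| ∂(Measure.pi fun _ : Fin k => ν) ≤ √k * √Var[Z; ν] := by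
  have hsum : MemLp (∑ i : Fin k, fun x : Fin k → E => Z (x i)) 2 (Measure.pi fun _ => ν) :=
    memLp_finsetSum' _ fun i _ => hZ.comp_measurePreserving (measurePreserving_eval _ i)
  have h := integral_abs_sub_integral_le_sqrt_variance hsum
  rw [variance_sum_pi fun _ => hZ] at h
  simpa [empiricalDeviation, integral_sum_pi (hZ.integrable one_le_two)] using h

theorem cgf_sum_pi {t : ℝ} (ht : t ∈ interior (integrableExpSet Z ν)) (k : ℕ) :
    cgf (∑ i : Fin k, fun x : Fin k → E => Z (x i)) (Measure.pi fun _ => ν) t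
      = k * cgf Z ν t := by
  have hZ := aemeasurable_of_mem_interior_integrableExpSet ht
  have hexp : Integrable (fun y => Real.exp (t * Z y)) ν :=
    integrable_of_mem_integrableExpSet (interior_subset ht)
  rw [(iIndepFun_pi fun _ => hZ).cgf_sum₀
    (fun i => hZ.comp_quasiMeasurePreserving (measurePreserving_eval _ i).quasiMeasurePreserving)
    fun i _ => integrable_comp_eval (μ := fun _ => ν) hexp]
  have hcgf (i : Fin k) : cgf (fun x : Fin k → E => Z (x i)) (Measure.pi fun _ => ν) t
      = cgf Z ν t :=
    congrArg Real.log (integral_comp_eval (μ := fun _ => ν) hexp.aestronglyMeasurable)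
  simp [hcgf]

theorem exists_pos_cgf_lt_mul (h : 0 ∈ interior (integrableExpSet Z ν)) {a : ℝ}
    (ha : ∫ y, Z y ∂ν < a) :
    ∃ t > 0, t ∈ interior (integrableExpSet Z ν) ∧ cgf Z ν t < t * a := by
  have hderiv : HasDerivAt (cgf Z ν) (∫ y, Z y ∂ν) 0 := by
    simpa [deriv_cgf_zero h] using (analyticAt_cgf h).differentiableAt.hasDerivAt
  have hslope := hderiv.tendsto_slope_zero_right
  simp only [zero_add, cgf_zero, sub_zero, smul_eq_mul] at hslope
  have hmem : ∀ᶠ t in 𝓝[>] (0 : ℝ), t ∈ interior (integrableExpSet Z ν) :=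
    nhdsWithin_le_nhds (isOpen_interior.mem_nhds h)
  obtain ⟨t, hlt, ht, hpos⟩ :=
    ((hslope.eventually_lt_const ha).and (hmem.and self_mem_nhdsWithin)).exists
  exact ⟨t, hpos, ht, by rwa [inv_mul_lt_iff₀ hpos] at hlt⟩

theorem exists_measureReal_le_sum_le_exp (h : 0 ∈ interior (integrableExpSet Z ν)) {a : ℝ}
    (ha : ∫ y, Z y ∂ν < a) :
    ∃ c > 0, ∀ k : ℕ, (Measure.pi fun _ : Fin k => ν).real {x | k * a ≤ ∑ i, Z (x i)}
      ≤ Real.exp (-c * k) := by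
  obtain ⟨t, ht, htI, hlt⟩ := exists_pos_cgf_lt_mul h ha
  refine ⟨t * a - cgf Z ν t, sub_pos.2 hlt, fun k => ?_⟩
  have hexp : Integrable (fun y => Real.exp (t * Z y)) ν :=
    integrable_of_mem_integrableExpSet (interior_subset htI)
  have hint : Integrable (fun x : Fin k → E => Real.exp (t * (∑ i, fun x : Fin k → E => Z (x i)) x))
      (Measure.pi fun _ => ν) := by
    simp only [Finset.sum_apply, Finset.mul_sum, Real.exp_sum]
    exact Integrable.fintype_prod fun _ => hexp
  have hchernoff := measure_ge_le_exp_cgf (k * a) ht.le hint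
  rw [cgf_sum_pi htI] at hchernoff
  simp only [Finset.sum_apply] at hchernoff
  exact hchernoff.trans_eq (congrArg _ (by ring))

theorem exists_measureReal_le_abs_empiricalDeviation_le
    (h : 0 ∈ interior (integrableExpSet Z ν)) {ε : ℝ} (hε : 0 < ε) :
    ∃ c > 0, ∀ k : ℕ,
      (Measure.pi fun _ : Fin k => ν).real {x | k * ε ≤ |empiricalDeviation ν Z x|}
        ≤ 2 * Real.exp (-c * k) := by
  obtain ⟨c₁, hc₁, hupper⟩ := exists_measureReal_le_sum_le_exp h (lt_add_of_pos_right _ hε)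
  obtain ⟨c₂, hc₂, hlower⟩ :=
    exists_measureReal_le_sum_le_exp (zero_mem_interior_integrableExpSet_neg h)
      (lt_add_of_pos_right _ hε)
  refine ⟨min c₁ c₂, lt_min hc₁ hc₂, fun k => ?_⟩
  have hsub : {x : Fin k → E | k * ε ≤ |empiricalDeviation ν Z x|}
      ⊆ {x | k * (∫ y, Z y ∂ν + ε) ≤ ∑ i, Z (x i)}
        ∪ {x | k * (∫ y, -Z y ∂ν + ε) ≤ ∑ i, -Z (x i)} := by
    intro x hx
    refine (le_abs.1 (show k * ε ≤ |_| from hx)).imp (fun hpos => ?_) fun hle => ?_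
    · rw [Set.mem_ofPred_eq, mul_add]
      exact (le_sub_iff_add_le').1 hpos
    · rw [Set.mem_ofPred_eq, Finset.sum_neg_distrib, integral_neg]
      rw [empiricalDeviation] at hle
      linarith
  calc (Measure.pi fun _ : Fin k => ν).real {x | k * ε ≤ |empiricalDeviation ν Z x|}
      ≤ Real.exp (-c₁ * k) + Real.exp (-c₂ * k) :=
        (measureReal_mono hsub).trans
          ((measureReal_union_le _ _).trans (add_le_add (hupper k) (hlower k)))
    _ ≤ Real.exp (-min c₁ c₂ * k) + Real.exp (-min c₁ c₂ * k) := by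
        gcongr
        · exact min_le_left _ _
        · exact min_le_right _ _
    _ = 2 * Real.exp (-min c₁ c₂ * k) := (two_mul _).symm

end Concentration

section SecondMoment

variable {d k : ℕ} {ν : Measure (Vec d)}

/-- The total deviation, over all pairs of coordinates, of the empirical second moments of the
sample `X` from `k` times the second moments of `ν`; it controls the distance between the Gram form
of the sample and its expectation. -/
def secondMomentDeviation (ν : Measure (Vec d)) (X : Fin k → Vec d) : ℝ :=
  ∑ p : Fin d × Fin d, |empiricalDeviation ν (fun x => x p.1 * x p.2) X|

theorem secondMomentDeviation_nonneg (X : Fin k → Vec d) : 0 ≤ secondMomentDeviation ν X :=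
  Finset.sum_nonneg fun _ _ => abs_nonneg _

theorem measurable_secondMomentDeviation (ν : Measure (Vec d)) :
    Measurable (secondMomentDeviation ν : (Fin k → Vec d) → ℝ) := by
  unfold secondMomentDeviation empiricalDeviation
  fun_prop

theorem inner_sq_eq_sum_coord_mul (x v : Vec d) :
    inner ℝ x v ^ 2 = ∑ p : Fin d × Fin d, v p.1 * v p.2 * (x p.1 * x p.2) := by
  rw [PiLp.inner_apply, sq, Finset.sum_mul_sum, Fintype.sum_prod_type]
  refine Finset.sum_congr rfl fun i _ => Finset.sum_congr rfl fun j _ => ?_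
  simp only [RCLike.inner_apply, conj_trivial]
  ring

theorem integrable_coord_mul (hν : MemLp id 2 ν) (i j : Fin d) :
    Integrable (fun x => x i * x j) ν :=
  ((hν.continuousLinearMap_comp (EuclideanSpace.proj i : Vec d →L[ℝ] ℝ)).integrable_mul
    (hν.continuousLinearMap_comp (EuclideanSpace.proj j : Vec d →L[ℝ] ℝ)))

theorem empiricalDeviation_inner_sq (hν : MemLp id 2 ν) (X : Fin k → Vec d) (v : Vec d) :
    empiricalDeviation ν (fun x => inner ℝ x v ^ 2) X
      = ∑ p : Fin d × Fin d,
          v p.1 * v p.2 * empiricalDeviation ν (fun x => x p.1 * x p.2) X := by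
  simp only [empiricalDeviation, inner_sq_eq_sum_coord_mul]
  rw [integral_finsetSum _ fun p _ => (integrable_coord_mul hν p.1 p.2).const_mul _,
    Finset.sum_comm]
  simp only [integral_const_mul, mul_sub, Finset.sum_sub_distrib, Finset.mul_sum, mul_left_comm]

theorem abs_coord_mul_le (x : Vec d) (i j : Fin d) : |x i * x j| ≤ ‖x‖ ^ 2 := by
  rw [abs_mul, sq]
  exact mul_le_mul (PiLp.norm_apply_le x i) (PiLp.norm_apply_le x j) (abs_nonneg _)
    (norm_nonneg _)

theorem abs_empiricalDeviation_inner_sq_le (hν : MemLp id 2 ν) (X : Fin k → Vec d) (v : Vec d) :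
    |empiricalDeviation ν (fun x => inner ℝ x v ^ 2) X| ≤ secondMomentDeviation ν X * ‖v‖ ^ 2 := by
  rw [empiricalDeviation_inner_sq hν, secondMomentDeviation, Finset.sum_mul]
  refine (Finset.abs_sum_le_sum_abs _ _).trans (Finset.sum_le_sum fun p _ => ?_)
  rw [abs_mul, mul_comm]
  exact mul_le_mul_of_nonneg_left (abs_coord_mul_le v p.1 p.2) (abs_nonneg _)

theorem exists_le_abs_empiricalDeviation_of_lt_secondMomentDeviation {X : Fin k → Vec d} {ε : ℝ}
    (hε : 0 ≤ ε) (h : k * ε < secondMomentDeviation ν X) :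
    ∃ p : Fin d × Fin d,
      k * (ε / (d ^ 2 + 1)) ≤ |empiricalDeviation ν (fun x => x p.1 * x p.2) X| := by
  have hconst : ∑ _p : Fin d × Fin d, k * (ε / (d ^ 2 + 1)) ≤ k * ε := by
    simp only [Finset.sum_const, Finset.card_univ, Fintype.card_prod, Fintype.card_fin,
      nsmul_eq_mul, Nat.cast_mul]
    rw [mul_left_comm, mul_div_left_comm]
    refine mul_le_mul_of_nonneg_left (mul_le_of_le_one_right hε ?_) k.cast_nonneg
    rw [div_le_one (by positivity)]
    linarith [sq (d : ℝ)]
  obtain ⟨p, -, hp⟩ := Finset.exists_lt_of_sum_lt (hconst.trans_lt h)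
  exact ⟨p, hp.le⟩

theorem sub_secondMomentDeviation_mul_le_sum_inner_sq (c : Vec d) (s : ℝ) (X : Fin k → Vec d)
    (v : Vec d) :
    (k * s ^ 2 - secondMomentDeviation (isoGaussian c s) X) * ‖v‖ ^ 2
      ≤ ∑ i, inner ℝ (X i) v ^ 2 := by
  have hdev := abs_empiricalDeviation_inner_sq_le (ν := isoGaussian c s)
    IsGaussian.memLp_two_id X v
  have hmean : ∫ x, inner ℝ x v ^ 2 ∂(isoGaussian c s) = inner ℝ v c ^ 2 + s ^ 2 * ‖v‖ ^ 2 := by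
    simpa only [real_inner_comm v] using integral_inner_sq_isoGaussian c v s
  rw [empiricalDeviation, hmean] at hdev
  nlinarith [neg_le_of_abs_le hdev, mul_nonneg k.cast_nonneg (sq_nonneg (inner ℝ v c))]

variable [IsGaussian ν]

theorem zero_mem_interior_integrableExpSet_coord_mul (i j : Fin d) :
    0 ∈ interior (integrableExpSet (fun x : Vec d => x i * x j) ν) := by
  obtain ⟨C, hC, hint⟩ := IsGaussian.exists_integrable_exp_sq ν
  rw [mem_interior_iff_mem_nhds]
  filter_upwards [Ioo_mem_nhds (neg_lt_zero.2 hC) hC] with t ht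
  refine hint.mono' (by fun_prop) (.of_forall fun x => ?_)
  rw [Real.norm_eq_abs, Real.abs_exp]
  refine Real.exp_le_exp.2 ((le_abs_self _).trans ?_)
  rw [abs_mul]
  exact mul_le_mul (abs_lt.2 ht).le (abs_coord_mul_le x i j) (abs_nonneg _) hC.le

theorem integrable_secondMomentDeviation (k : ℕ) :
    Integrable (secondMomentDeviation ν) (Measure.pi fun _ : Fin k => ν) :=
  integrable_finsetSum _ fun p _ => (integrable_empiricalDeviation
    (integrable_coord_mul IsGaussian.memLp_two_id p.1 p.2) k).abs

theorem exists_integral_secondMomentDeviation_le_mul_sqrt (ν : Measure (Vec d)) [IsGaussian ν] :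
    ∃ C, 0 ≤ C ∧ ∀ k : ℕ,
      ∫ X, secondMomentDeviation ν X ∂(Measure.pi fun _ : Fin k => ν) ≤ C * √k := by
  refine ⟨∑ p : Fin d × Fin d, √Var[fun x => x p.1 * x p.2; ν],
    Finset.sum_nonneg fun _ _ => Real.sqrt_nonneg _, fun k => ?_⟩
  simp only [secondMomentDeviation]
  rw [integral_finsetSum _ fun p _ => (integrable_empiricalDeviation
    (integrable_coord_mul IsGaussian.memLp_two_id p.1 p.2) k).abs, Finset.sum_mul]
  refine Finset.sum_le_sum fun p _ => ?_
  rw [mul_comm]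
  exact integral_abs_empiricalDeviation_le (memLp_of_mem_interior_integrableExpSet
    (zero_mem_interior_integrableExpSet_coord_mul p.1 p.2) 2) k

theorem exp_neg_le_factorial_div_pow {x : ℝ} (hx : 0 < x) (n : ℕ) :
    Real.exp (-x) ≤ n.factorial / x ^ n := by
  rw [Real.exp_neg, ← inv_div]
  exact inv_anti₀ (by positivity) (Real.pow_div_factorial_le_exp x hx.le n)

theorem exists_measureReal_lt_secondMomentDeviation_le_div_pow (ν : Measure (Vec d)) [IsGaussian ν]
    {ε : ℝ} (hε : 0 < ε) (n : ℕ) :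
    ∃ C, 0 ≤ C ∧ ∀ k : ℕ, 0 < k →
      (Measure.pi fun _ : Fin k => ν).real {X | k * ε < secondMomentDeviation ν X} ≤ C / k ^ n := by
  have hε' : 0 < ε / (d ^ 2 + 1) := by positivity
  choose c hc hle using fun p : Fin d × Fin d => exists_measureReal_le_abs_empiricalDeviation_le
    (zero_mem_interior_integrableExpSet_coord_mul (ν := ν) p.1 p.2) hε'
  refine ⟨∑ p, 2 * (n.factorial / c p ^ n),
    Finset.sum_nonneg fun p _ => by have := hc p; positivity, fun k hk => ?_⟩
  have hk' : (0 : ℝ) < k := Nat.cast_pos.2 hk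
  have hsub : {X : Fin k → Vec d | k * ε < secondMomentDeviation ν X}
      ⊆ ⋃ p : Fin d × Fin d,
        {X | k * (ε / (d ^ 2 + 1)) ≤ |empiricalDeviation ν (fun x => x p.1 * x p.2) X|} := by
    intro X hX
    exact Set.mem_iUnion.2 (exists_le_abs_empiricalDeviation_of_lt_secondMomentDeviation hε.le hX)
  calc (Measure.pi fun _ : Fin k => ν).real {X | k * ε < secondMomentDeviation ν X}
      ≤ ∑ p, 2 * Real.exp (-c p * k) := (measureReal_mono hsub).trans
        ((measureReal_iUnion_fintype_le _).trans (Finset.sum_le_sum fun p _ => hle p k))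
    _ ≤ ∑ p, 2 * (n.factorial / (c p * k) ^ n) := by
        gcongr with p
        rw [neg_mul]
        exact exp_neg_le_factorial_div_pow (mul_pos (hc p) hk') n
    _ = (∑ p, 2 * (n.factorial / c p ^ n)) / k ^ n := by
        rw [Finset.sum_div]
        refine Finset.sum_congr rfl fun p _ => ?_
        rw [mul_pow, ← div_div, mul_div_assoc]

end SecondMoment

section ICLRisk

variable {d k : ℕ} {muStar wStar : Vec d} {tau : ℝ}

theorem iclRisk_le_ofReal_integral_mul {f : Prompt d k → ℝ} {g : (Fin k → Vec d) → ℝ}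
    (hg : Integrable g (Measure.pi fun _ => isoGaussian muStar tau)) (hg0 : ∀ X, 0 ≤ g X)
    (hf : ∀ X x, (f (fun i => (X i, inner ℝ (X i) wStar), x) - inner ℝ x wStar) ^ 2
      ≤ g X * ‖x‖ ^ 2) :
    iclRisk muStar wStar tau k f
      ≤ ENNReal.ofReal ((∫ X, g X ∂(Measure.pi fun _ => isoGaussian muStar tau))
          * (‖muStar‖ ^ 2 + d * tau ^ 2)) := by
  have hsplit := measurePreserving_comp_injective_prodMk_eval
    (fun _ : Fin (k + 1) => isoGaussian muStar tau) (Fin.castSucc_injective k)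
    (j := Fin.last k) fun i => i.castSucc_ne_last
  have hgm : AEMeasurable (fun X => ENNReal.ofReal (g X))
      (Measure.pi fun _ : Fin k => isoGaussian muStar tau) := hg.aemeasurable.ennreal_ofReal
  have hxm : AEMeasurable (fun x : Vec d => ENNReal.ofReal (‖x‖ ^ 2)) (isoGaussian muStar tau) := by
    fun_prop
  calc iclRisk muStar wStar tau k f
      ≤ ∫⁻ x : Fin (k + 1) → Vec d, ENNReal.ofReal (g fun i => x i.castSucc)
          * ENNReal.ofReal (‖x (Fin.last k)‖ ^ 2) ∂(Measure.pi fun _ => isoGaussian muStar tau) :=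
        lintegral_mono fun x => by
          rw [← ENNReal.ofReal_mul (hg0 _)]
          exact ENNReal.ofReal_le_ofReal (hf _ _)
    _ = ∫⁻ q : (Fin k → Vec d) × Vec d, ENNReal.ofReal (g q.1) * ENNReal.ofReal (‖q.2‖ ^ 2)
          ∂((Measure.pi fun _ => isoGaussian muStar tau).prod (isoGaussian muStar tau)) := by
        rw [← hsplit.map_eq, lintegral_map' _ hsplit.aemeasurable]
        rw [hsplit.map_eq]
        exact (hgm.comp_quasiMeasurePreserving Measure.quasiMeasurePreserving_fst).mul
          (hxm.comp_quasiMeasurePreserving Measure.quasiMeasurePreserving_snd)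
    _ = _ := by
        rw [lintegral_prod_mul hgm hxm, lintegral_norm_sq_isoGaussian,
          ← ofReal_integral_eq_lintegral_ofReal hg (.of_forall hg0),
          ENNReal.ofReal_mul (integral_nonneg hg0)]

theorem one_div_sq_one_sub_le {r : ℝ} (h0 : 0 ≤ r) (h1 : r ≤ 1 / 2) :
    1 / (1 - r) ^ 2 ≤ 1 + 6 * r := by
  rw [div_le_iff₀ (by nlinarith)]
  nlinarith [mul_nonneg h0 (mul_nonneg (sub_nonneg.2 h1) (show 0 ≤ 4 - 3 * r by linarith))]

theorem one_div_sq_one_add_mul_sub_le {δ T R : ℝ} (hδ : 0 < δ) (hT : 0 < T) (hR0 : 0 ≤ R)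
    (hR : R ≤ T / 2) : 1 / (1 + δ * (T - R)) ^ 2 ≤ (1 + 6 * (R / T)) / (δ * T) ^ 2 := by
  have hr : R / T ≤ 1 / 2 := by rw [div_le_iff₀ hT]; linarith
  have hfactor : δ * (T - R) = δ * T * (1 - R / T) := by field_simp
  have hpos : 0 < δ * T * (1 - R / T) := mul_pos (mul_pos hδ hT) (by linarith)
  calc 1 / (1 + δ * (T - R)) ^ 2 ≤ 1 / (δ * T * (1 - R / T)) ^ 2 := by
        rw [hfactor]
        gcongr
        linarith
    _ = 1 / (1 - R / T) ^ 2 / (δ * T) ^ 2 := by rw [mul_pow, div_div, mul_comm]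
    _ ≤ (1 + 6 * (R / T)) / (δ * T) ^ 2 := by
        gcongr
        exact one_div_sq_one_sub_le (div_nonneg hR0 hT.le) hr

/-- A bound for the squared contraction factor `1 / (1 + δ λ) ^ 2` of a ridge estimator whose Gram
form is bounded below by `λ = max (T - R) 0`. The first term covers the typical case `R ≤ T / 2`,
the second one the exceptional case `T / 2 < R`, where `λ` may vanish. -/
def ridgeErrorEnvelope (δ T R : ℝ) : ℝ :=
  (1 + 6 * (R / T)) / (δ * T) ^ 2 + (Set.Ioi (T / 2)).indicator 1 R

theorem ridgeErrorEnvelope_nonneg {δ T R : ℝ} (hT : 0 ≤ T) (hR : 0 ≤ R) :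
    0 ≤ ridgeErrorEnvelope δ T R :=
  add_nonneg (by positivity) (Set.indicator_nonneg (fun _ _ => zero_le_one) _)

theorem PretrainModel.sq_bayesPredictor_sub_inner_le {M : ℕ} (P : PretrainModel d M)
    (muStar wStar : Vec d) (htau : 0 < tau) (hk : 0 < k) (X : Fin k → Vec d) (x : Vec d) :
    (P.bayesPredictor k (fun i => (X i, inner ℝ (X i) wStar), x) - inner ℝ x wStar) ^ 2
      ≤ (1 + ‖wStar‖) ^ 2 * ridgeErrorEnvelope P.deltaW (k * tau ^ 2)
          (secondMomentDeviation (isoGaussian muStar tau) X) * ‖x‖ ^ 2 := by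
  set R := secondMomentDeviation (isoGaussian muStar tau) X
  have hR : 0 ≤ R := secondMomentDeviation_nonneg X
  have hT : 0 < k * tau ^ 2 := by positivity
  have hδ := P.deltaW_pos
  suffices ∃ l, 0 ≤ l ∧ (∀ v, l * ‖v‖ ^ 2 ≤ ∑ i, inner ℝ (X i) v ^ 2) ∧
      1 / (1 + P.deltaW * l) ^ 2 ≤ ridgeErrorEnvelope P.deltaW (k * tau ^ 2) R by
    obtain ⟨l, hl, hX, hle⟩ := this
    calc (P.bayesPredictor k (fun i => (X i, inner ℝ (X i) wStar), x) - inner ℝ x wStar) ^ 2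
        ≤ ((1 + ‖wStar‖) / (1 + P.deltaW * l) * ‖x‖) ^ 2 :=
          sq_le_sq.2 ((P.abs_bayesPredictor_sub_inner_le X x wStar hl hX).trans (le_abs_self _))
      _ = (1 + ‖wStar‖) ^ 2 * (1 / (1 + P.deltaW * l) ^ 2) * ‖x‖ ^ 2 := by
        rw [mul_pow, div_pow, ← mul_one_div]
      _ ≤ _ := by gcongr
  rcases le_or_gt R (k * tau ^ 2 / 2) with hgood | hbad
  · refine ⟨k * tau ^ 2 - R, by linarith,
      sub_secondMomentDeviation_mul_le_sum_inner_sq muStar tau X, ?_⟩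
    rw [ridgeErrorEnvelope, Set.indicator_of_notMem (Set.notMem_Ioi.2 hgood), add_zero]
    exact one_div_sq_one_add_mul_sub_le hδ hT hR hgood
  · refine ⟨0, le_rfl, fun v => ?_, ?_⟩
    · rw [zero_mul]
      exact Finset.sum_nonneg fun i _ => sq_nonneg _
    · rw [ridgeErrorEnvelope, Set.indicator_of_mem (Set.mem_Ioi.2 hbad), mul_zero, add_zero,
        one_pow, div_one, Pi.one_apply]
      exact le_add_of_nonneg_left (by positivity)

theorem integrable_indicator_secondMomentDeviation (ν : Measure (Vec d)) [IsProbabilityMeasure ν]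
    (T : ℝ) :
    Integrable (fun X : Fin k → Vec d =>
      (Set.Ioi T).indicator (1 : ℝ → ℝ) (secondMomentDeviation ν X)) (Measure.pi fun _ => ν) :=
  (integrable_const (1 : ℝ)).indicator (measurable_secondMomentDeviation ν measurableSet_Ioi)

theorem integrable_ridgeErrorEnvelope (ν : Measure (Vec d)) [IsGaussian ν] (δ T : ℝ) :
    Integrable (fun X : Fin k → Vec d => ridgeErrorEnvelope δ T (secondMomentDeviation ν X))
      (Measure.pi fun _ => ν) :=
  (((integrable_const 1).add (((integrable_secondMomentDeviation k).div_const T).const_mul 6)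
    ).div_const _).add (integrable_indicator_secondMomentDeviation ν _)

theorem integral_ridgeErrorEnvelope (ν : Measure (Vec d)) [IsGaussian ν] (δ T : ℝ) :
    ∫ X : Fin k → Vec d, ridgeErrorEnvelope δ T (secondMomentDeviation ν X) ∂(Measure.pi fun _ => ν)
      = (1 + 6 * ((∫ X : Fin k → Vec d, secondMomentDeviation ν X ∂(Measure.pi fun _ => ν)) / T))
          / (δ * T) ^ 2
        + (Measure.pi fun _ : Fin k => ν).real {X | T / 2 < secondMomentDeviation ν X} := by
  have hR : Integrable (fun X : Fin k → Vec d => 6 * (secondMomentDeviation ν X / T))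
      (Measure.pi fun _ => ν) := ((integrable_secondMomentDeviation k).div_const T).const_mul 6
  have haffine : Integrable (fun X : Fin k → Vec d =>
      (1 + 6 * (secondMomentDeviation ν X / T)) / (δ * T) ^ 2) (Measure.pi fun _ => ν) :=
    ((integrable_const 1).add hR).div_const _
  have hindicator : ∫ X : Fin k → Vec d, (Set.Ioi (T / 2)).indicator (1 : ℝ → ℝ)
      (secondMomentDeviation ν X) ∂(Measure.pi fun _ => ν)
        = (Measure.pi fun _ : Fin k => ν).real {X | T / 2 < secondMomentDeviation ν X} :=
    integral_indicator_one (measurable_secondMomentDeviation ν measurableSet_Ioi)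
  simp only [ridgeErrorEnvelope]
  rw [integral_add haffine (integrable_indicator_secondMomentDeviation ν _), hindicator,
    integral_div, integral_add (integrable_const 1) hR, integral_const_mul, integral_div]
  simp

theorem exists_integral_ridgeErrorEnvelope_le (ν : Measure (Vec d)) [IsGaussian ν] {δ : ℝ}
    (hδ : 0 < δ) (htau : 0 < tau) :
    ∃ C, 0 ≤ C ∧ ∀ k : ℕ, 0 < k →
      ∫ X : Fin k → Vec d, ridgeErrorEnvelope δ (k * tau ^ 2) (secondMomentDeviation ν X)
          ∂(Measure.pi fun _ => ν)
        ≤ 1 / (tau ^ 4 * δ ^ 2 * k ^ 2) + C * (k : ℝ) ^ (-(5 / 2) : ℝ) := by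
  obtain ⟨C₁, hC₁, hmean⟩ := exists_integral_secondMomentDeviation_le_mul_sqrt ν
  obtain ⟨C₂, hC₂, htail⟩ := exists_measureReal_lt_secondMomentDeviation_le_div_pow ν
    (show 0 < tau ^ 2 / 2 by positivity) 3
  refine ⟨6 * C₁ / (tau ^ 6 * δ ^ 2) + C₂, by positivity, fun k hk => ?_⟩
  have hk0 : (0 : ℝ) < k := Nat.cast_pos.2 hk
  have hsqrt : √(k : ℝ) / k ^ 3 = (k : ℝ) ^ (-(5 / 2) : ℝ) := by
    rw [Real.sqrt_eq_rpow, ← Real.rpow_natCast, ← Real.rpow_sub hk0]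
    norm_num
  have hcube : 1 / (k : ℝ) ^ 3 ≤ (k : ℝ) ^ (-(5 / 2) : ℝ) := by
    rw [← hsqrt]
    gcongr
    exact Real.one_le_sqrt.2 (Nat.one_le_cast.2 hk)
  rw [integral_ridgeErrorEnvelope, mul_div_assoc]
  calc (1 + 6 * ((∫ X : Fin k → Vec d, secondMomentDeviation ν X ∂(Measure.pi fun _ => ν))
          / (k * tau ^ 2))) / (δ * (k * tau ^ 2)) ^ 2
        + (Measure.pi fun _ : Fin k => ν).real {X | k * (tau ^ 2 / 2) < secondMomentDeviation ν X}
      ≤ (1 + 6 * (C₁ * √k / (k * tau ^ 2))) / (δ * (k * tau ^ 2)) ^ 2 + C₂ / k ^ 3 := by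
        gcongr
        exacts [hmean k, htail k hk]
    _ = 1 / (tau ^ 4 * δ ^ 2 * k ^ 2) + 6 * C₁ / (tau ^ 6 * δ ^ 2) * (√k / k ^ 3)
          + C₂ * (1 / k ^ 3) := by
        field_simp
    _ ≤ 1 / (tau ^ 4 * δ ^ 2 * k ^ 2)
          + (6 * C₁ / (tau ^ 6 * δ ^ 2) + C₂) * (k : ℝ) ^ (-(5 / 2) : ℝ) := by
        rw [hsqrt, add_mul, ← add_assoc]
        gcongr

theorem PretrainModel.exists_iclRisk_bayesPredictor_lt {M : ℕ} (P : PretrainModel d M)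
    (muStar wStar : Vec d) (htau : 0 < tau) :
    ∃ C, 0 ≤ C ∧ ∀ k : ℕ, 0 < k → iclRisk muStar wStar tau k (P.bayesPredictor k) <
      ENNReal.ofReal ((1 + ‖wStar‖) ^ 2 * (‖muStar‖ ^ 2 + d * tau ^ 2)
          / (tau ^ 4 * P.deltaW ^ 2 * (k : ℝ) ^ 2) + C * (k : ℝ) ^ (-(5 / 2) : ℝ)) := by
  obtain ⟨C, hC, hle⟩ :=
    exists_integral_ridgeErrorEnvelope_le (isoGaussian muStar tau) P.deltaW_pos htau
  set A := (1 + ‖wStar‖) ^ 2 * (‖muStar‖ ^ 2 + d * tau ^ 2) with hA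
  have hA0 : 0 ≤ A := by positivity
  refine ⟨A * C + 1, by positivity, fun k hk => ?_⟩
  have hpow : 0 < (k : ℝ) ^ (-(5 / 2) : ℝ) := Real.rpow_pos_of_pos (Nat.cast_pos.2 hk) _
  have hrisk := iclRisk_le_ofReal_integral_mul
    ((integrable_ridgeErrorEnvelope (isoGaussian muStar tau) P.deltaW (k * tau ^ 2)).const_mul
      ((1 + ‖wStar‖) ^ 2))
    (fun X => mul_nonneg (sq_nonneg _)
      (ridgeErrorEnvelope_nonneg (by positivity) (secondMomentDeviation_nonneg X)))
    (P.sq_bayesPredictor_sub_inner_le muStar wStar htau hk)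
  rw [integral_const_mul, mul_right_comm, ← hA] at hrisk
  refine hrisk.trans_lt ((ENNReal.ofReal_lt_ofReal_iff (by positivity)).2 ?_)
  calc A * _ ≤ A * (1 / (tau ^ 4 * P.deltaW ^ 2 * k ^ 2) + C * (k : ℝ) ^ (-(5 / 2) : ℝ)) :=
        mul_le_mul_of_nonneg_left (hle k hk) hA0
    _ = A / (tau ^ 4 * P.deltaW ^ 2 * k ^ 2) + A * C * (k : ℝ) ^ (-(5 / 2) : ℝ) := by ring
    _ < _ := by linarith

end ICLRisk

theorem theorem4_general {d M : ℕ} (P : PretrainModel d M) (muStar wStar : Vec d) {tau : ℝ}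
    (htau : 0 < tau) :
    (∀ k, Continuous (P.bayesPredictor k)) ∧
    (∀ K : ℕ, P.IsOptimal K (fun k => P.bayesPredictor k)) ∧
    ∃ C : ℝ, 0 ≤ C ∧ ∀ (K : ℕ) (k : Fin K), 0 < (k : ℕ) →
      ∀ F : Predictor d K, Continuous (F k) → P.IsOptimal K F →
        iclRisk muStar wStar tau k (F k) <
          ENNReal.ofReal ((1 + ‖wStar‖) ^ 2 * (‖muStar‖ ^ 2 + d * tau ^ 2)
              / (tau ^ 4 * P.deltaW ^ 2 * ((k : ℕ) : ℝ) ^ 2)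
            + C * ((k : ℕ) : ℝ) ^ (-(5 / 2) : ℝ)) := by
  obtain ⟨C, hC, hrisk⟩ := P.exists_iclRisk_bayesPredictor_lt muStar wStar htau
  refine ⟨P.continuous_bayesPredictor, P.isOptimal_bayesPredictor, C, hC,
    fun K k hk F hcont hF => ?_⟩
  rw [P.eq_bayesPredictor_of_isOptimal hF hcont]
  exact hrisk k hk

end

theorem theorem4 {d M : ℕ} (P : PretrainModel d M) (muStar wStar : Vec d)
    (hmu : ‖muStar‖ = 1) (hw : ‖wStar‖ = 1) (tau : ℝ) (htau : 0 < tau) :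
    -- the Bayes predictor is continuous and attains the optimal pretraining risk
    (∀ k, Continuous (P.bayesPredictor k)) ∧
    (∀ K : ℕ, P.IsOptimal K (fun k => P.bayesPredictor k)) ∧
    -- the risk bound for every continuous predictor attaining the optimal pretraining risk
    ∀ δ : ℝ, 0 < δ → ∃ (C : ℝ) (k₀ : ℕ), ∀ (K : ℕ) (k : Fin K), k₀ ≤ (k : ℕ) →
      ∀ F : Predictor d K, (∀ j, Continuous (F j)) → P.IsOptimal K F →
        iclRisk muStar wStar tau k (F k) <
          ENNReal.ofReal
            (4 * (1 + d * tau ^ 2) / (tau ^ 4 * P.deltaW ^ 2 * ((k : ℕ) : ℝ) ^ 2)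
              + C * ((k : ℕ) : ℝ) ^ (δ - 5 / 2)) := by
  obtain ⟨hcont, hopt, C, hC, hrisk⟩ := theorem4_general P muStar wStar htau
  refine ⟨hcont, hopt, fun δ hδ => ⟨C, 1, fun K k hk F hF hFopt =>
    (hrisk K k hk F (hF k) hFopt).trans_le (ENNReal.ofReal_le_ofReal ?_)⟩⟩
  rw [hmu, hw]
  norm_num only
  gcongr
  · exact_mod_cast hk
  · linarith
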